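/- Let $\mathrm{E}=\{(0),(ij),(k)\mid 1\le i<j\le 5,\ 1\le k\le 5\}$ and let $\hat{\mathrm{E}}=\{\beta^r\mid \beta\in \mathrm{E},\ r\in\mathbb{Z}\}$, partially ordered by the reflexive-transitive closure of the following relations, for all $r\in\mathbb{Z}$: $(0)^r<(12)^r<(13)^r$; $(13)^r<(14)^r$; $(13)^r<(23)^r$; $(14)^r<(15)^r$; $(14)^r<(24)^r$; $(23)^r<(24)^r$; $(15)^r<(25)^r$; $(24)^r<(25)^r$; $(24)^r<(34)^r$; $(25)^r<(35)^r$; $(34)^r<(35)^r$; $(34)^r<(5)^r$; $(35)^r<(45)^r$; $(35)^r<(4)^r$; $(5)^r<(4)^r$; $(45)^r<(3)^r$; $(4)^r<(3)^r<(2)^r<(1)^r$; $(45)^r<(0)^{r+1}$; $(3)^r<(12)^{r+1}$; $(2)^r<(13)^{r+1}$; $(1)^r<(23)^{r+1}$. Intervals are $[\delta,\delta']=\{\alpha\in\hat{\mathrm{E}}\mid \delta\le\alpha\le\delta'\}$; in particular $[(0)^N,(1)^{N'}]=\{\beta^l\mid N\le l\le N'\}$. The cone of pure spinors is given by the ten quadratic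 equations $\lambda p_i-\mathrm{Pf}_i(w)=0$ and $\sum_{j=1}^5 p_jw_{ji}=0$ $(1\le i\le 5)$ in the $16$ variables $\lambda=\lambda^{(0)}$, $w_{ij}=-w_{ji}=\lambda^{(ij)}$ $(i<j)$, $p_i=\lambda^{(i)}$, where $\mathrm{Pf}_i(w)$ is $(-1)^{i+1}$ times the Pfaffian of the skew matrix $w$ with the $i$-th row and column removed. For $\mathrm{X}\subset[(0)^N,(1)^{N'}]$ let $A[\mathrm{X}]$ be the quotient of the polynomial ring $\mathbb{C}[\lambda^{\alpha}\mid \alpha\in[(0)^N,(1)^{N'}]]$ by the ideal generated by all $\lambda^\alpha$ with $\alpha\notin\mathrm{X}$ and by all coefficients of powers of $z$ in the ten equations evaluated at $\lambda^{\beta}(z)=\sum_{N\le l\le N'}\lambda^{\beta^l}z^l$, $\beta\in \mathrm{E}$; this does not depend on $N,N'$. Put $A[\delta,\delta']=A[\mathrm{X}]$ for $\mathrm{X}=[\delta,\delta']$. For $\mathrm{X}\subset\mathrm{Y}$ the projection $\mathsf{p}:A[\mathrm{Y}]\to A[\mathrm{X}]$ sends $\lambda^\alpha$ to $\lambda^\alpha$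 if $\alpha\in\mathrm{X}$ and to $0$ otherwise. For an algebra $A$ graded by degree and generated by a finite-dimensional $V=A_1$, with $I=\ker(V\otimes V\to A_2)$, the quadratic (Koszul) dual is $A^!=T(V^*)/(I^\perp)$, where $I^\perp\subset V^*\otimes V^*$ is the annihilator of $I$. A graded homomorphism $f:A\to B$ induces an algebra homomorphism $f^!:B^!\to A^!$ that on generators is the transpose $B_1^*\to A_1^*$ of $f|_{A_1}:A_1\to B_1$. Proposition. For any intervals $[\gamma,\gamma']\subset[\delta,\delta']$ in $\hat{\mathrm{E}}$, the homomorphism $\mathsf{p}^!:A^![\gamma,\gamma']\to A^![\delta,\delta']$ induced by the projection $\mathsf{p}:A[\delta,\delta']\to A[\gamma,\gamma']$ is injective. -/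

import Mathlib

open scoped TensorProduct

noncomputable section

/-! ## The quadratic dual of an algebra generated in degree one -/

section QuadraticDual

variable {k A B : Type*} [Field k] [Ring A] [Algebra k A] [Ring B] [Algebra k B]

/-- The quadratic relations `I ⊆ V ⊗ V` of an algebra `A` with degree-one part `V ⊆ A`:
the kernel of the multiplication map `V ⊗ V → A`. -/
def quadraticRelations (V : Submodule k A) : Submodule k (V ⊗[k] V) :=
  LinearMap.ker (LinearMap.mul' k A ∘ₗ TensorProduct.map V.subtype V.subtype)

/-- The orthogonal complement `I^⊥ ⊆ V* ⊗ V*` of the quadratic relations, for the pairing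
`⟨f ⊗ g, v ⊗ w⟩ = f v * g w`. -/
def dualRelations (V : Submodule k A) :
    Submodule k (Module.Dual k V ⊗[k] Module.Dual k V) :=
  (quadraticRelations V).dualAnnihilator.comap (TensorProduct.dualDistrib k V V)

/-- The canonical map `W ⊗ W → T(W)` onto the degree-two part of the tensor algebra. -/
def tensorSquareι (k W : Type*) [Field k] [AddCommGroup W] [Module k W] :
    W ⊗[k] W →ₗ[k] TensorAlgebra k W :=
  LinearMap.mul' k (TensorAlgebra k W) ∘ₗ
    TensorProduct.map (TensorAlgebra.ι k) (TensorAlgebra.ι k)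

/-- The elements of `I^⊥`, viewed in `T(V*)`, are set equal to zero. -/
def dualRel (V : Submodule k A) (x y : TensorAlgebra k (Module.Dual k V)) : Prop :=
  (∃ t ∈ dualRelations V, x = tensorSquareι k (Module.Dual k V) t) ∧ y = 0

/-- The quadratic dual `A^! = T(V*) / (I^⊥)`. -/
abbrev QuadraticDual (V : Submodule k A) : Type _ := RingQuot (dualRel V)

/-- The linear map `V → W` between degree-one parts induced by an algebra map `f : A → B`. -/
def degreeOneMap (V : Submodule k A) (W : Submodule k B) (f : A →ₐ[k] B)
    (hf : V ≤ W.comap f.toLinearMap) : V →ₗ[k] W :=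
  f.toLinearMap.restrict hf

theorem dualRelations_map (V : Submodule k A) (W : Submodule k B) (f : A →ₐ[k] B)
    (hf : V ≤ W.comap f.toLinearMap) {t : Module.Dual k W ⊗[k] Module.Dual k W}
    (ht : t ∈ dualRelations W) :
    TensorProduct.map (degreeOneMap V W f hf).dualMap (degreeOneMap V W f hf).dualMap t ∈
      dualRelations V := by
  have key : ∀ (s : Module.Dual k W ⊗[k] Module.Dual k W) (r : V ⊗[k] V),
      TensorProduct.dualDistrib k V V
        (TensorProduct.map (degreeOneMap V W f hf).dualMap
          (degreeOneMap V W f hf).dualMap s) r =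
      TensorProduct.dualDistrib k W W s
        (TensorProduct.map (degreeOneMap V W f hf) (degreeOneMap V W f hf) r) := by
    intro s r
    induction s using TensorProduct.induction_on with
    | zero => simp
    | add a b ha hb => simp only [map_add, LinearMap.add_apply, ha, hb]
    | tmul a b =>
      induction r using TensorProduct.induction_on with
      | zero => simp
      | add a b ha hb => simp only [map_add, ha, hb]
      | tmul v w => simp
  have hmul : ∀ r : V ⊗[k] V,
      LinearMap.mul' k B (TensorProduct.map W.subtype W.subtype
        (TensorProduct.map (degreeOneMap V W f hf) (degreeOneMap V W f hf) r)) =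
      f (LinearMap.mul' k A (TensorProduct.map V.subtype V.subtype r)) := by
    intro r
    induction r using TensorProduct.induction_on with
    | zero => simp
    | add a b ha hb => simp only [map_add, ha, hb]
    | tmul v w => simp [degreeOneMap]
  rw [dualRelations, Submodule.mem_comap, Submodule.mem_dualAnnihilator] at ht ⊢
  intro r hr
  rw [key]
  apply ht
  rw [quadraticRelations, LinearMap.mem_ker, LinearMap.comp_apply] at hr ⊢
  rw [hmul, hr, map_zero]

/-- The algebra map `T(W*) → T(V*)` induced by the transpose of `V → W`. -/
def tensorDualMap (V : Submodule k A) (W : Submodule k B) (f : A →ₐ[k] B)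
    (hf : V ≤ W.comap f.toLinearMap) :
    TensorAlgebra k (Module.Dual k W) →ₐ[k] TensorAlgebra k (Module.Dual k V) :=
  TensorAlgebra.lift k (TensorAlgebra.ι k ∘ₗ (degreeOneMap V W f hf).dualMap)

theorem tensorDualMap_tensorSquareι (V : Submodule k A) (W : Submodule k B) (f : A →ₐ[k] B)
    (hf : V ≤ W.comap f.toLinearMap) (t : Module.Dual k W ⊗[k] Module.Dual k W) :
    tensorDualMap V W f hf (tensorSquareι k _ t) =
      tensorSquareι k _ (TensorProduct.map (degreeOneMap V W f hf).dualMap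
        (degreeOneMap V W f hf).dualMap t) := by
  induction t using TensorProduct.induction_on with
  | zero => simp
  | add a b ha hb => simp only [map_add, ha, hb]
  | tmul a b => simp [tensorDualMap, tensorSquareι]

/-- The algebra map `f^! : B^! → A^!` induced by an algebra map `f : A → B` that carries the
degree-one part of `A` into that of `B`: on generators it is the transpose of `V → W`. -/
def QuadraticDual.map (V : Submodule k A) (W : Submodule k B) (f : A →ₐ[k] B)
    (hf : V ≤ W.comap f.toLinearMap) : QuadraticDual W →ₐ[k] QuadraticDual V :=
  RingQuot.liftAlgHom k ⟨(RingQuot.mkAlgHom k (dualRel V)).comp (tensorDualMap V W f hf), by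
    rintro x y ⟨⟨t, ht, rfl⟩, rfl⟩
    simp only [AlgHom.comp_apply, map_zero, tensorDualMap_tensorSquareι]
    rw [← map_zero (RingQuot.mkAlgHom k (dualRel V))]
    exact RingQuot.mkAlgHom_rel k ⟨⟨_, dualRelations_map V W f hf ht, rfl⟩, rfl⟩⟩

end QuadraticDual

/-! ## The poset `Ê` -/

/-- The set `E = {(0), (ij), (k)}` of labels of spinor coordinates. -/
inductive SpinorLabel : Type
  | s0
  | s12 | s13 | s14 | s15 | s23 | s24 | s25 | s34 | s35 | s45
  | s1 | s2 | s3 | s4 | s5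

/-- The set `Ê` of decorated labels `β^r`, with `β ∈ E` and `r ∈ ℤ`. -/
@[ext]
structure AffineLabel : Type where
  label : SpinorLabel
  level : ℤ

namespace AffineLabel

open SpinorLabel

/-- The edges of the Hasse diagram of `Ê`; `HasseEdge α β` means that `β` covers `α`. -/
inductive HasseEdge : AffineLabel → AffineLabel → Prop
  | e_0_12 (r : ℤ) : HasseEdge ⟨s0, r⟩ ⟨s12, r⟩
  | e_12_13 (r : ℤ) : HasseEdge ⟨s12, r⟩ ⟨s13, r⟩
  | e_13_14 (r : ℤ) : HasseEdge ⟨s13, r⟩ ⟨s14, r⟩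
  | e_13_23 (r : ℤ) : HasseEdge ⟨s13, r⟩ ⟨s23, r⟩
  | e_14_15 (r : ℤ) : HasseEdge ⟨s14, r⟩ ⟨s15, r⟩
  | e_14_24 (r : ℤ) : HasseEdge ⟨s14, r⟩ ⟨s24, r⟩
  | e_23_24 (r : ℤ) : HasseEdge ⟨s23, r⟩ ⟨s24, r⟩
  | e_15_25 (r : ℤ) : HasseEdge ⟨s15, r⟩ ⟨s25, r⟩
  | e_24_25 (r : ℤ) : HasseEdge ⟨s24, r⟩ ⟨s25, r⟩
  | e_24_34 (r : ℤ) : HasseEdge ⟨s24, r⟩ ⟨s34, r⟩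
  | e_25_35 (r : ℤ) : HasseEdge ⟨s25, r⟩ ⟨s35, r⟩
  | e_34_35 (r : ℤ) : HasseEdge ⟨s34, r⟩ ⟨s35, r⟩
  | e_34_5 (r : ℤ) : HasseEdge ⟨s34, r⟩ ⟨s5, r⟩
  | e_35_45 (r : ℤ) : HasseEdge ⟨s35, r⟩ ⟨s45, r⟩
  | e_35_4 (r : ℤ) : HasseEdge ⟨s35, r⟩ ⟨s4, r⟩
  | e_5_4 (r : ℤ) : HasseEdge ⟨s5, r⟩ ⟨s4, r⟩
  | e_45_3 (r : ℤ) : HasseEdge ⟨s45, r⟩ ⟨s3, r⟩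
  | e_4_3 (r : ℤ) : HasseEdge ⟨s4, r⟩ ⟨s3, r⟩
  | e_3_2 (r : ℤ) : HasseEdge ⟨s3, r⟩ ⟨s2, r⟩
  | e_2_1 (r : ℤ) : HasseEdge ⟨s2, r⟩ ⟨s1, r⟩
  | e_45_0 (r : ℤ) : HasseEdge ⟨s45, r⟩ ⟨s0, r + 1⟩
  | e_3_12 (r : ℤ) : HasseEdge ⟨s3, r⟩ ⟨s12, r + 1⟩
  | e_2_13 (r : ℤ) : HasseEdge ⟨s2, r⟩ ⟨s13, r + 1⟩
  | e_1_23 (r : ℤ) : HasseEdge ⟨s1, r⟩ ⟨s23, r + 1⟩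

/-- The rank of a label within its level. -/
def baseRank : SpinorLabel → ℤ
  | s0 => 0
  | s12 => 1
  | s13 => 2
  | s14 => 3
  | s23 => 3
  | s15 => 4
  | s24 => 4
  | s25 => 5
  | s34 => 5
  | s35 => 6
  | s5 => 6
  | s45 => 7
  | s4 => 7
  | s3 => 8
  | s2 => 9
  | s1 => 10

/-- The rank function of the graded poset `Ê`. -/
def rank (α : AffineLabel) : ℤ := baseRank α.label + 8 * α.level

theorem HasseEdge.rank_eq {α β : AffineLabel} (h : HasseEdge α β) : β.rank = α.rank + 1 := by
  cases h <;> simp only [rank, baseRank] <;> ring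

theorem rank_le_of_reflTransGen {α β : AffineLabel} (h : Relation.ReflTransGen HasseEdge α β) :
    α = β ∨ α.rank < β.rank := by
  induction h with
  | refl => exact Or.inl rfl
  | tail _ hbc ih =>
    right
    have := hbc.rank_eq
    rcases ih with rfl | ih <;> omega

/-- The partial order on `Ê` generated by the Hasse diagram. -/
instance : PartialOrder AffineLabel where
  le α β := Relation.ReflTransGen HasseEdge α β
  le_refl _ := Relation.ReflTransGen.refl
  le_trans _ _ _ h₁ h₂ := h₁.trans h₂
  le_antisymm α β h₁ h₂ := by
    rcases rank_le_of_reflTransGen h₁ with h | h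
    · exact h
    · rcases rank_le_of_reflTransGen h₂ with h' | h'
      · exact h'.symm
      · omega

end AffineLabel

/-! ## The algebras `A[X]` -/

open SpinorLabel in
/-- The ten quadratic equations of the cone of pure spinors, with `λ = v (0)`, `p_i = v (i)`,
`w_ij = v (ij)` for `i < j` and `w_ji = - w_ij`: first the five `λ p_i - Pf_i(w)`, where `Pf_i(w)`
is `(-1)^(i+1)` times the Pfaffian of `w` with row and column `i` removed, then the five entries
`∑ i, p_i w_ij` of `p w`. -/
def pureSpinorEquation {R : Type*} [CommRing R] (v : SpinorLabel → R) : Fin 5 ⊕ Fin 5 → R :=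
  Sum.elim
    ![v s0 * v s1 - (v s23 * v s45 - v s24 * v s35 + v s25 * v s34),
      v s0 * v s2 + (v s13 * v s45 - v s14 * v s35 + v s15 * v s34),
      v s0 * v s3 - (v s12 * v s45 - v s14 * v s25 + v s15 * v s24),
      v s0 * v s4 + (v s12 * v s35 - v s13 * v s25 + v s15 * v s23),
      v s0 * v s5 - (v s12 * v s34 - v s13 * v s24 + v s14 * v s23)]
    ![-(v s2 * v s12) - v s3 * v s13 - v s4 * v s14 - v s5 * v s15,
      v s1 * v s12 - v s3 * v s23 - v s4 * v s24 - v s5 * v s25,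
      v s1 * v s13 + v s2 * v s23 - v s4 * v s34 - v s5 * v s35,
      v s1 * v s14 + v s2 * v s24 + v s3 * v s34 - v s5 * v s45,
      v s1 * v s15 + v s2 * v s25 + v s3 * v s35 + v s4 * v s45]

/-- The polynomial ring with one variable `λ^α` for every `α ∈ Ê`. -/
abbrev AffinePoly : Type := MvPolynomial AffineLabel ℂ

/-- The generating function `λ^β(z) = ∑_{N ≤ l ≤ N'} λ^(β^l) z^l`. -/
def spinorSeries (N N' : ℤ) (β : SpinorLabel) : LaurentPolynomial AffinePoly :=
  ∑ l ∈ Finset.Icc N N',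
    LaurentPolynomial.C (MvPolynomial.X ⟨β, l⟩) * LaurentPolynomial.T l

/-- The relation `Γ^(s^k)`: the coefficient of `z^k` in the pure spinor equation number `s`
evaluated at the generating functions `λ^β(z)`. -/
def affineRelation (N N' : ℤ) (s : Fin 5 ⊕ Fin 5) (k : ℤ) : AffinePoly :=
  (pureSpinorEquation (spinorSeries N N') s).coeff k

/-- The ideal defining `A[X]`, for `X` contained in some interval `[(0)^N, (1)^N']`.  It is
generated by all `λ^α` with `α ∉ X` and by the relations `Γ^(s^k)`. The choice of `N`, `N'` with
`X ⊆ [(0)^N, (1)^N']` is immaterial, since `Γ^(s^k)` for two choices differ by multiples of the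
`λ^α` with `α ∉ X`; all choices are put in. -/
def relationIdeal (X : Set AffineLabel) : Ideal AffinePoly :=
  Ideal.span
    ({f | ∃ α ∉ X, f = MvPolynomial.X α} ∪
      {f | ∃ N N' : ℤ, X ⊆ Set.Icc ⟨SpinorLabel.s0, N⟩ ⟨SpinorLabel.s1, N'⟩ ∧
        ∃ (s : Fin 5 ⊕ Fin 5) (k : ℤ), f = affineRelation N N' s k})

/-- The algebra `A[X]`. -/
abbrev SpinorAlgebra (X : Set AffineLabel) : Type := AffinePoly ⧸ relationIdeal X

/-- The degree-one component of `A[X]`, spanned by the classes of the `λ^α`. -/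
def degreeOne (X : Set AffineLabel) : Submodule ℂ (SpinorAlgebra X) :=
  (MvPolynomial.homogeneousSubmodule AffineLabel ℂ 1).map
    (Ideal.Quotient.mkₐ ℂ (relationIdeal X)).toLinearMap

theorem relationIdeal_anti {X Y : Set AffineLabel} (h : X ⊆ Y) :
    relationIdeal Y ≤ relationIdeal X := by
  apply Ideal.span_mono
  rintro f (⟨α, hα, rfl⟩ | ⟨N, N', hN, s, k, rfl⟩)
  · exact Or.inl ⟨α, fun hx => hα (h hx), rfl⟩
  · exact Or.inr ⟨N, N', h.trans hN, s, k, rfl⟩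

/-- The projection `p : A[Y] → A[X]` for `X ⊆ Y`: the class of a polynomial goes to its class, so
`λ^α` goes to `λ^α` if `α ∈ X` and to zero otherwise. -/
def projection {X Y : Set AffineLabel} (h : X ⊆ Y) : SpinorAlgebra Y →ₐ[ℂ] SpinorAlgebra X :=
  Ideal.Quotient.factorₐ ℂ (relationIdeal_anti h)

theorem degreeOne_le_comap_projection {X Y : Set AffineLabel} (h : X ⊆ Y) :
    degreeOne Y ≤ (degreeOne X).comap (projection h).toLinearMap := by
  rintro _ ⟨f, hf, rfl⟩
  exact ⟨f, hf, rfl⟩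

/-- The Koszul (quadratic) dual `A^![X]` of `A[X]`. -/
abbrev KoszulDual (X : Set AffineLabel) : Type := QuadraticDual (degreeOne X)

/-- The algebra map `p^! : A^![X] → A^![Y]` induced by the projection `p : A[Y] → A[X]`. -/
def koszulDualMap {X Y : Set AffineLabel} (h : X ⊆ Y) : KoszulDual X →ₐ[ℂ] KoszulDual Y :=
  QuadraticDual.map (degreeOne Y) (degreeOne X) (projection h) (degreeOne_le_comap_projection h)

end

/-!
For a convex set `X` of labels, the algebra `A^![X]` has generators `θ_x`, `x ∈ X`. Each product
`λ^x λ^y` occurs in at most one coefficient of one of the ten quadrics, with sign `±1`, and among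
the products occurring in a given coefficient there is exactly one of incomparable labels `σ`, `τ`;
if `x` and `y` are comparable, then `σ` and `τ` lie between them. So the relations of `A^![X]` say
that the anticommutator `{θ_x, θ_y}` of comparable labels is `± {θ_σ, θ_τ}`, or zero if `λ^x λ^y`
occurs in no quadric, and they are among the relations of one algebra with a generator for every
label in `Ê`, independent of `X`. It remains to see that the latter algebra has no more relations
among the `θ_x`, `x ∈ X`, than `A^![X]`.

Read the relation for `y ≤ x` as a rewriting rule for the word `x y`, with result
`- y x ± (σ τ + τ σ)`. It terminates, since it lowers the sum of the squares of the ranks or keeps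
it and lowers the number of inversions. It is confluent by the diamond lemma
(`exists_normalForm`). The overlap `x ≥ y ≥ z` resolves if the Jacobi identity for `θ_x`, `θ_y`,
`θ_z` follows from relations between words of smaller square rank
(`RespectsBelow.jacobi_of_comparable`). Let `A_(s,k)` be `± {θ_σ, θ_τ}` for the pair `σ`, `τ` in
the coefficient of `z^k` in the quadric `s`. Applying the Jacobi identity to `σ`, `τ`, `x`
repeatedly expresses each commutator `[A_(s,k), θ_x]` by commutators of smaller square rank, down
to zero or to a unique ground triple for each weight. So
`[A_(s,k), θ_x] = Γ_(sx)^δ W_(δ,t)`, where `Γ` are the structure constants of the quadrics and the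
`W_(δ,t)` depend only on the weight (`RespectsBelow.commGap_eq_zero`). The Jacobi identity then is
the Fierz identity for the `Γ`, a finite check (`fierz`).

Rewriting a word in the labels of `X` stays within `X` and is valid in `A^![X]`. Therefore letting
`A^![Y]` act on words, applying it to the empty word and evaluating the result in `A^![X]` is a
left inverse of `p^! : A^![X] → A^![Y]` (`koszulDualMap_injective`).
-/

/-! ### The vector labels and the ten quadrics -/

namespace SpinorLabel

/-- The weight of a label, as a set of indices written in binary: `(0)` is `∅`, `(ij)` is
`{i, j}` and `(k)` is the complement of `{k}`. -/
def code : SpinorLabel → ℕ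
  | s0 => 0
  | s12 => 3
  | s13 => 5
  | s14 => 9
  | s15 => 17
  | s23 => 6
  | s24 => 10
  | s25 => 18
  | s34 => 12
  | s35 => 20
  | s45 => 24
  | s1 => 30
  | s2 => 29
  | s3 => 27
  | s4 => 23
  | s5 => 15

theorem code_injective : Function.Injective code := by
  intro a b h
  cases a <;> cases b <;> first | rfl | exact absurd h (by decide)

instance : DecidableEq SpinorLabel := fun _ _ => decidable_of_iff _ code_injective.eq_iff

instance : Fintype SpinorLabel where
  elems := {s0, s12, s13, s14, s15, s23, s24, s25, s34, s35, s45, s1, s2, s3, s4, s5}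
  complete a := by cases a <;> decide

/-- The four terms `± λ^a λ^b` of each of the ten quadrics, as triples `(±1, a, b)`. -/
def terms : Fin 5 ⊕ Fin 5 → List (ℤ × SpinorLabel × SpinorLabel)
  | .inl 0 => [(1, s0, s1), (-1, s23, s45), (1, s24, s35), (-1, s25, s34)]
  | .inl 1 => [(1, s0, s2), (1, s13, s45), (-1, s14, s35), (1, s15, s34)]
  | .inl 2 => [(1, s0, s3), (-1, s12, s45), (1, s14, s25), (-1, s15, s24)]
  | .inl 3 => [(1, s0, s4), (1, s12, s35), (-1, s13, s25), (1, s15, s23)]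
  | .inl 4 => [(1, s0, s5), (-1, s12, s34), (1, s13, s24), (-1, s14, s23)]
  | .inr 0 => [(-1, s2, s12), (-1, s3, s13), (-1, s4, s14), (-1, s5, s15)]
  | .inr 1 => [(1, s1, s12), (-1, s3, s23), (-1, s4, s24), (-1, s5, s25)]
  | .inr 2 => [(1, s1, s13), (1, s2, s23), (-1, s4, s34), (-1, s5, s35)]
  | .inr 3 => [(1, s1, s14), (1, s2, s24), (1, s3, s34), (-1, s5, s45)]
  | .inr 4 => [(1, s1, s15), (1, s2, s25), (1, s3, s35), (1, s4, s45)]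

theorem pureSpinorEquation_eq_sum {R : Type*} [CommRing R] (v : SpinorLabel → R)
    (s : Fin 5 ⊕ Fin 5) :
    pureSpinorEquation v s = ((terms s).map fun t => t.1 • (v t.2.1 * v t.2.2)).sum := by
  rcases s with i | i <;> fin_cases i <;> simp [pureSpinorEquation, terms] <;> ring

/-- The sign with which the label `a` occurs in the quadric `s`; zero if it does not occur. -/
def coef (s : Fin 5 ⊕ Fin 5) (a : SpinorLabel) : ℤ :=
  ((terms s).find? fun t => t.2.1 = a ∨ t.2.2 = a).elim 0 fun t => t.1

/-- The label multiplied with `a` in the quadric `s`; it is `a` itself if `a` does not occur. -/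
def mate (s : Fin 5 ⊕ Fin 5) (a : SpinorLabel) : SpinorLabel :=
  ((terms s).find? fun t => t.2.1 = a ∨ t.2.2 = a).elim a
    fun t => if t.2.1 = a then t.2.2 else t.2.1

/-- The quadric in which the product of two labels occurs. The weights of the two labels then
agree in exactly one index. The value is `inl 0` if there is no such quadric. -/
def vec (a b : SpinorLabel) : Fin 5 ⊕ Fin 5 :=
  match code a ^^^ code b with
  | 30 => if (code a).testBit 0 then .inr 0 else .inl 0
  | 29 => if (code a).testBit 1 then .inr 1 else .inl 1
  | 27 => if (code a).testBit 2 then .inr 2 else .inl 2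
  | 23 => if (code a).testBit 3 then .inr 3 else .inl 3
  | 15 => if (code a).testBit 4 then .inr 4 else .inl 4
  | _ => .inl 0

/-- The sign with which the product of two labels occurs in a quadric; zero if it occurs in
none. -/
def sgn (a b : SpinorLabel) : ℤ := if mate (vec a b) a = b then coef (vec a b) a else 0

/-- The quadric of opposite weight. -/
def dual : Fin 5 ⊕ Fin 5 → Fin 5 ⊕ Fin 5
  | .inl i => .inr i
  | .inr i => .inl i

theorem sgn_comm : ∀ a b, sgn a b = sgn b a := by decide +kernel

theorem vec_comm : ∀ a b, vec a b = vec b a := by decide +kernel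

theorem sgn_self : ∀ a, sgn a a = 0 := by decide +kernel

theorem sgn_mul_self : ∀ a b, sgn a b ≠ 0 → sgn a b * sgn a b = 1 := by decide +kernel

theorem coef_mul_self : ∀ s a, coef s a ≠ 0 → coef s a * coef s a = 1 := by decide +kernel

theorem mate_mate : ∀ s a, mate s (mate s a) = a := by decide +kernel

theorem coef_mate : ∀ s a, coef s (mate s a) = coef s a := by decide +kernel

/-- The Fierz identity for the structure constants `Γ^s_(ab) = sgn a b` of the quadrics: the sum
of `Γ^s_(ab) Γ^(s')_(cd)` over the quadrics `s`, with `s'` the quadric of opposite weight, and over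
the cyclic permutations of `a`, `b`, `c` is zero for all `d`. As `d` is determined by `s` and `c`,
this says that the three terms have the same `d` where they are nonzero and add up to zero. -/
theorem fierz : ∀ a b c,
    (sgn a b * coef (dual (vec a b)) c ≠ 0 → sgn a c * coef (dual (vec a c)) b ≠ 0 →
      mate (dual (vec a b)) c = mate (dual (vec a c)) b) ∧
    (sgn a b * coef (dual (vec a b)) c ≠ 0 → sgn b c * coef (dual (vec b c)) a ≠ 0 →
      mate (dual (vec a b)) c = mate (dual (vec b c)) a) ∧
    (sgn a c * coef (dual (vec a c)) b ≠ 0 → sgn b c * coef (dual (vec b c)) a ≠ 0 →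
      mate (dual (vec a c)) b = mate (dual (vec b c)) a) ∧
    sgn a b * coef (dual (vec a b)) c + sgn a c * coef (dual (vec a c)) b +
      sgn b c * coef (dual (vec b c)) a = 0 := by
  decide +kernel

end SpinorLabel

/-! ### The order of `Ê` as a planar lattice -/

namespace AffineLabel

open SpinorLabel

theorem ext_iff' {x y : AffineLabel} : x = y ↔ x.label = y.label ∧ x.level = y.level :=
  ⟨fun h => h ▸ ⟨rfl, rfl⟩, fun h => AffineLabel.ext h.1 h.2⟩

instance : DecidableEq AffineLabel := fun _ _ => decidable_of_iff _ ext_iff'.symm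

/-- The second coordinate of a label in the planar drawing of `Ê` whose first coordinate is the
rank: a covering relation changes it by `±1`. -/
def diff : SpinorLabel → ℤ
  | s0 => 2
  | s12 => 1
  | s13 => 0
  | s14 => 1
  | s15 => 2
  | s23 => -1
  | s24 => 0
  | s25 => 1
  | s34 => -1
  | s35 => 0
  | s45 => 1
  | s1 => -2
  | s2 => -1
  | s3 => 0
  | s4 => -1
  | s5 => -2

/-- A decidable form of the order of `Ê`: the second label lies in the forward cone of the first
in the planar drawing. -/
def Below (x y : AffineLabel) : Prop := |diff y.label - diff x.label| ≤ y.rank - x.rank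

instance (x y : AffineLabel) : Decidable (Below x y) := inferInstanceAs (Decidable (_ ≤ _))

/-- The element with the level raised by `m`. -/
def shift (m : ℤ) (x : AffineLabel) : AffineLabel := ⟨x.label, x.level + m⟩

theorem rank_shift (m : ℤ) (x : AffineLabel) : (shift m x).rank = x.rank + 8 * m := by
  simp only [rank, shift]; ring

theorem below_shift {m : ℤ} {x y : AffineLabel} : Below (shift m x) (shift m y) ↔ Below x y := by
  have h : (shift m y).rank - (shift m x).rank = y.rank - x.rank := by
    rw [rank_shift, rank_shift]; ring
  unfold Below
  rw [h]
  rfl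

theorem shift_eq_iff {m : ℤ} {x y : AffineLabel} : shift m x = shift m y ↔ x = y := by
  simp [ext_iff', shift]

theorem exists_eq_shift (x : AffineLabel) : x = shift x.level ⟨x.label, 0⟩ := by
  simp [shift]

theorem Below.rank_le {x y : AffineLabel} (h : Below x y) : x.rank ≤ y.rank := by
  have := (abs_nonneg _).trans h
  linarith

theorem Below.rank_lt {x y : AffineLabel} (h : Below x y) (hne : x ≠ y) : x.rank < y.rank := by
  refine lt_of_le_of_ne h.rank_le fun hr => hne ?_
  have key : ∀ a b, ∀ d ∈ Finset.Icc (-2 : ℤ) 2, diff a = diff b →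
      baseRank a = baseRank b + 8 * d → a = b ∧ d = 0 := by decide +kernel
  have hb : ∀ a, 0 ≤ baseRank a ∧ baseRank a ≤ 10 := by decide +kernel
  have hd : diff y.label = diff x.label := by
    rw [Below, hr, sub_self] at h
    have := abs_eq_zero.1 (le_antisymm h (abs_nonneg _))
    linarith
  have h1 := hb x.label
  have h2 := hb y.label
  simp only [rank] at hr
  obtain ⟨h3, h4⟩ := key x.label y.label (y.level - x.level)
    (by rw [Finset.mem_Icc]; omega) hd.symm (by linarith)
  exact AffineLabel.ext h3 (by linarith)

/-- The elements covering a label of level zero, as pairs of a label and a level. -/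
def covers : SpinorLabel → List (SpinorLabel × ℤ)
  | s0 => [(s12, 0)]
  | s12 => [(s13, 0)]
  | s13 => [(s14, 0), (s23, 0)]
  | s14 => [(s15, 0), (s24, 0)]
  | s15 => [(s25, 0)]
  | s23 => [(s24, 0)]
  | s24 => [(s25, 0), (s34, 0)]
  | s25 => [(s35, 0)]
  | s34 => [(s35, 0), (s5, 0)]
  | s35 => [(s45, 0), (s4, 0)]
  | s45 => [(s3, 0), (s0, 1)]
  | s1 => [(s23, 1)]
  | s2 => [(s1, 0), (s13, 1)]
  | s3 => [(s2, 0), (s12, 1)]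
  | s4 => [(s3, 0)]
  | s5 => [(s4, 0)]

theorem hasseEdge_of_mem_covers {a : SpinorLabel} {c : SpinorLabel × ℤ} (h : c ∈ covers a)
    (m : ℤ) : HasseEdge ⟨a, m⟩ ⟨c.1, m + c.2⟩ := by
  cases a <;> simp only [covers, List.mem_cons, List.not_mem_nil, or_false] at h <;>
    (first | subst h | rcases h with rfl | rfl) <;> simp only [add_zero] <;> constructor

theorem exists_cover_below {a b : SpinorLabel} {d : ℤ} (h : Below ⟨a, 0⟩ ⟨b, d⟩)
    (hne : (⟨a, 0⟩ : AffineLabel) ≠ ⟨b, d⟩) :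
    ∃ c ∈ covers a, Below ⟨c.1, c.2⟩ ⟨b, d⟩ := by
  have key : ∀ a b, ∀ d ∈ Finset.Icc (-2 : ℤ) 3, Below ⟨a, 0⟩ ⟨b, d⟩ →
      (⟨a, 0⟩ : AffineLabel) ≠ ⟨b, d⟩ → ∃ c ∈ covers a, Below ⟨c.1, c.2⟩ ⟨b, d⟩ := by
    decide +kernel
  have hb : ∀ a, (0 ≤ baseRank a ∧ baseRank a ≤ 10) ∧ -2 ≤ diff a ∧ diff a ≤ 2 := by
    decide +kernel
  have hc : ∀ a, ∃ c ∈ covers a, c.2 ≤ 1 := by decide +kernel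
  have h0 := h.rank_le
  have h1 := hb a
  have h2 := hb b
  simp only [rank] at h0
  by_cases hd : d ≤ 3
  · exact key a b d (by rw [Finset.mem_Icc]; omega) h hne
  · obtain ⟨c, hc1, hc2⟩ := hc a
    have h3 := hb c.1
    refine ⟨c, hc1, ?_⟩
    rw [Below, abs_le]
    simp only [rank]
    omega

theorem Below.le {x y : AffineLabel} (h : Below x y) : x ≤ y := by
  obtain ⟨n, hn⟩ : ∃ n : ℕ, y.rank - x.rank = n :=
    ⟨_, (Int.toNat_of_nonneg (sub_nonneg.2 h.rank_le)).symm⟩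
  induction n generalizing x with
  | zero =>
    by_cases hxy : x = y
    · exact hxy.le
    · have := h.rank_lt hxy
      omega
  | succ n ih =>
    have hxy : x ≠ y := by rintro rfl; simp at hn; omega
    have hy : y = shift x.level ⟨y.label, y.level - x.level⟩ := by simp [shift]
    rw [exists_eq_shift x, hy] at h hxy
    obtain ⟨c, hc, hcb⟩ := exists_cover_below (below_shift.1 h) (mt shift_eq_iff.2 hxy)
    have he := hasseEdge_of_mem_covers hc x.level
    rw [← below_shift (m := x.level), ← hy] at hcb
    have hs : shift x.level ⟨c.1, c.2⟩ = ⟨c.1, x.level + c.2⟩ := by simp [shift, add_comm]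
    rw [hs] at hcb
    have hr : AffineLabel.rank ⟨c.1, x.level + c.2⟩ = x.rank + 1 := he.rank_eq
    exact (Relation.ReflTransGen.single he : x ≤ _).trans (ih hcb (by push_cast at hn; omega))

theorem level_le_of_le {x y : AffineLabel} (h : x ≤ y) : x.level ≤ y.level := by
  change Relation.ReflTransGen HasseEdge x y at h
  induction h with
  | refl => exact le_rfl
  | tail _ hbc ih => cases hbc <;> simp only at ih ⊢ <;> omega

theorem mem_Icc_s0_s1 {x : AffineLabel} {N N' : ℤ} (h : N ≤ x.level) (h' : x.level ≤ N') :
    x ∈ Set.Icc (⟨s0, N⟩ : AffineLabel) ⟨s1, N'⟩ := by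
  have hb : ∀ a, |diff a - diff s0| ≤ baseRank a - baseRank s0 ∧
      |diff s1 - diff a| ≤ baseRank s1 - baseRank a := by decide +kernel
  constructor
  · apply Below.le
    have := (hb x.label).1
    simp only [Below, rank]
    linarith
  · apply Below.le
    have := (hb x.label).2
    simp only [Below, rank]
    linarith

/-! ### The incomparable pair of a vector weight -/

/-- The first label of the incomparable pair in the coefficient of `z^k`, `k` even, in the
quadric `s`; both labels have level `k / 2`. -/
def evenFst : Fin 5 ⊕ Fin 5 → SpinorLabel
  | .inl 0 => s25
  | .inl 4 => s14
  | .inl _ => s15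
  | .inr 4 => s4
  | .inr _ => s5

/-- The second label of the incomparable pair for even powers of `z`. -/
def evenSnd : Fin 5 ⊕ Fin 5 → SpinorLabel
  | .inl 0 => s34
  | .inl 1 => s34
  | .inl 2 => s24
  | .inl 3 => s23
  | .inl 4 => s23
  | .inr 0 => s15
  | .inr 1 => s25
  | .inr 2 => s35
  | .inr 3 => s45
  | .inr 4 => s45

/-- The first label of the incomparable pair in the coefficient of `z^k`, `k` odd, in the
quadric `s`; it has level `(k + 1) / 2`. -/
def oddFst : Fin 5 ⊕ Fin 5 → SpinorLabel
  | .inl _ => s0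
  | .inr 0 => s12
  | .inr 1 => s12
  | .inr 2 => s13
  | .inr 3 => s14
  | .inr 4 => s15

/-- The second label of the incomparable pair for odd powers of `z`; it has level
`(k - 1) / 2`. -/
def oddSnd : Fin 5 ⊕ Fin 5 → SpinorLabel
  | .inl 0 => s1
  | .inl 1 => s2
  | .inl 2 => s3
  | .inl 3 => s4
  | .inl 4 => s5
  | .inr 0 => s2
  | .inr _ => s1

/-- The first member of the unique incomparable pair whose product occurs in the coefficient of
`z^k` in the quadric `s`. -/
def incFst (s : Fin 5 ⊕ Fin 5) (k : ℤ) : AffineLabel :=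
  if k % 2 = 0 then ⟨evenFst s, k / 2⟩ else ⟨oddFst s, k / 2 + 1⟩

/-- The second member of the unique incomparable pair whose product occurs in the coefficient of
`z^k` in the quadric `s`. -/
def incSnd (s : Fin 5 ⊕ Fin 5) (k : ℤ) : AffineLabel :=
  if k % 2 = 0 then ⟨evenSnd s, k / 2⟩ else ⟨oddSnd s, k / 2⟩

theorem incFst_add (s : Fin 5 ⊕ Fin 5) (k m : ℤ) :
    incFst s (k + 2 * m) = shift m (incFst s k) := by
  have h1 : (k + 2 * m) % 2 = k % 2 := by omega
  have h2 : (k + 2 * m) / 2 = k / 2 + m := by omega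
  unfold incFst
  rw [h1, h2]
  split_ifs <;> simp only [shift, AffineLabel.mk.injEq, true_and]
  ring

theorem incSnd_add (s : Fin 5 ⊕ Fin 5) (k m : ℤ) :
    incSnd s (k + 2 * m) = shift m (incSnd s k) := by
  have h1 : (k + 2 * m) % 2 = k % 2 := by omega
  have h2 : (k + 2 * m) / 2 = k / 2 + m := by omega
  unfold incSnd
  rw [h1, h2]
  split_ifs <;> simp only [shift]

theorem inc_level_add (s : Fin 5 ⊕ Fin 5) (k : ℤ) :
    (incFst s k).level + (incSnd s k).level = k := by
  unfold incFst incSnd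
  split_ifs <;> simp only <;> omega

theorem sgn_inc_mul_self (s : Fin 5 ⊕ Fin 5) (k : ℤ) :
    sgn (incFst s k).label (incSnd s k).label * sgn (incFst s k).label (incSnd s k).label = 1 := by
  have key : ∀ s, sgn (evenFst s) (evenSnd s) * sgn (evenFst s) (evenSnd s) = 1 ∧
    sgn (oddFst s) (oddSnd s) * sgn (oddFst s) (oddSnd s) = 1 := by decide +kernel
  unfold incFst incSnd
  split_ifs
  exacts [(key s).1, (key s).2]

theorem vec_inc (s : Fin 5 ⊕ Fin 5) (k : ℤ) :
    vec (incFst s k).label (incSnd s k).label = s := by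
  have key : ∀ s, vec (evenFst s) (evenSnd s) = s ∧ vec (oddFst s) (oddSnd s) = s := by
    decide +kernel
  unfold incFst incSnd
  split_ifs
  exacts [(key s).1, (key s).2]

/-- The first member of the incomparable pair of the weight of `λ^x λ^y`: this product occurs in
the quadric `vec x.label y.label`, and the power of `z` is the sum of the levels. -/
abbrev meet₁ (x y : AffineLabel) : AffineLabel :=
  incFst (vec x.label y.label) (x.level + y.level)

/-- The second member of the incomparable pair of the weight of `λ^x λ^y`. -/
abbrev meet₂ (x y : AffineLabel) : AffineLabel :=
  incSnd (vec x.label y.label) (x.level + y.level)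

theorem meet₁_comm (x y : AffineLabel) : meet₁ x y = meet₁ y x := by
  rw [meet₁, meet₁, vec_comm, add_comm]

theorem meet₂_comm (x y : AffineLabel) : meet₂ x y = meet₂ y x := by
  rw [meet₂, meet₂, vec_comm, add_comm]

theorem rank_meet_add {x y : AffineLabel} (h : sgn x.label y.label ≠ 0) :
    (meet₁ x y).rank + (meet₂ x y).rank = x.rank + y.rank := by
  have key : ∀ a b, sgn a b ≠ 0 →
      baseRank (evenFst (vec a b)) + baseRank (evenSnd (vec a b)) = baseRank a + baseRank b ∧
      baseRank (oddFst (vec a b)) + baseRank (oddSnd (vec a b)) = baseRank a + baseRank b := by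
    decide +kernel
  obtain ⟨h1, h2⟩ := key _ _ h
  unfold meet₁ meet₂ incFst incSnd
  split_ifs <;> simp only [rank] <;> omega

/-- Comparable labels whose product occurs in a quadric enclose the incomparable pair of the same
weight, strictly in rank. -/
theorem meet_between {x y : AffineLabel} (h : sgn x.label y.label ≠ 0) (hxy : Below x y) :
    (Below x (meet₁ x y) ∧ Below (meet₁ x y) y) ∧ (Below x (meet₂ x y) ∧ Below (meet₂ x y) y) ∧
      |(meet₁ x y).rank - (meet₂ x y).rank| < y.rank - x.rank := by
  suffices H : ∀ (a b : SpinorLabel) (d : ℤ), sgn a b ≠ 0 → Below ⟨a, 0⟩ ⟨b, d⟩ →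
      (Below ⟨a, 0⟩ (meet₁ ⟨a, 0⟩ ⟨b, d⟩) ∧ Below (meet₁ ⟨a, 0⟩ ⟨b, d⟩) ⟨b, d⟩) ∧
      (Below ⟨a, 0⟩ (meet₂ ⟨a, 0⟩ ⟨b, d⟩) ∧ Below (meet₂ ⟨a, 0⟩ ⟨b, d⟩) ⟨b, d⟩) ∧
      |(meet₁ ⟨a, 0⟩ ⟨b, d⟩).rank - (meet₂ ⟨a, 0⟩ ⟨b, d⟩).rank| <
        AffineLabel.rank ⟨b, d⟩ - AffineLabel.rank ⟨a, 0⟩ by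
    have hx : x = shift x.level ⟨x.label, 0⟩ := by simp [shift]
    have hy : y = shift x.level ⟨y.label, y.level - x.level⟩ := by simp [shift]
    have hk : x.level + y.level = (0 + (y.level - x.level)) + 2 * x.level := by ring
    have h1 : meet₁ x y = shift x.level (meet₁ ⟨x.label, 0⟩ ⟨y.label, y.level - x.level⟩) := by
      rw [meet₁, hk, incFst_add]
    have h2 : meet₂ x y = shift x.level (meet₂ ⟨x.label, 0⟩ ⟨y.label, y.level - x.level⟩) := by
      rw [meet₂, hk, incSnd_add]
    have hb : Below ⟨x.label, 0⟩ ⟨y.label, y.level - x.level⟩ := by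
      rw [← below_shift (m := x.level), ← hx, ← hy]
      exact hxy
    obtain ⟨⟨c1, c2⟩, ⟨c3, c4⟩, c5⟩ := H x.label y.label (y.level - x.level) h hb
    rw [← below_shift (m := x.level), ← h1] at c1 c2
    rw [← below_shift (m := x.level), ← h2] at c3 c4
    rw [← hx] at c1 c3
    rw [← hy] at c2 c4
    refine ⟨⟨c1, c2⟩, ⟨c3, c4⟩, ?_⟩
    have c6 := congrArg AffineLabel.rank hx
    have c7 := congrArg AffineLabel.rank hy
    rw [rank_shift] at c6 c7
    rw [h1, h2, rank_shift, rank_shift, add_sub_add_right_eq_sub]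
    linarith
  intro a b d hs hab
  have key : ∀ a b, ∀ d ∈ Finset.Icc (-2 : ℤ) 3, sgn a b ≠ 0 → Below ⟨a, 0⟩ ⟨b, d⟩ →
      (Below ⟨a, 0⟩ (meet₁ ⟨a, 0⟩ ⟨b, d⟩) ∧ Below (meet₁ ⟨a, 0⟩ ⟨b, d⟩) ⟨b, d⟩) ∧
      (Below ⟨a, 0⟩ (meet₂ ⟨a, 0⟩ ⟨b, d⟩) ∧ Below (meet₂ ⟨a, 0⟩ ⟨b, d⟩) ⟨b, d⟩) ∧
      |(meet₁ ⟨a, 0⟩ ⟨b, d⟩).rank - (meet₂ ⟨a, 0⟩ ⟨b, d⟩).rank| <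
        AffineLabel.rank ⟨b, d⟩ - AffineLabel.rank ⟨a, 0⟩ := by decide +kernel
  have hb : ∀ a, (0 ≤ baseRank a ∧ baseRank a ≤ 10) ∧ -2 ≤ diff a ∧ diff a ≤ 2 := by
    decide +kernel
  by_cases hd : d ≤ 3
  · have h0 := hab.rank_le
    have h1 := hb a
    have h2 := hb b
    simp only [rank] at h0
    exact key a b d (by rw [Finset.mem_Icc]; omega) hs hab
  -- For `d ≥ 4` the ranks are so far apart that only the rank sum matters.
  · have hi : ∀ s, |baseRank (evenFst s) - baseRank (evenSnd s)| ≤ 2 ∧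
        |baseRank (oddFst s) + 8 - baseRank (oddSnd s)| ≤ 2 := by decide +kernel
    have h1 := hb a
    have h2 := hb b
    have h3 := rank_meet_add (x := ⟨a, 0⟩) (y := ⟨b, d⟩) hs
    have h4 := (hb (meet₁ ⟨a, 0⟩ ⟨b, d⟩).label).2
    have h5 := (hb (meet₂ ⟨a, 0⟩ ⟨b, d⟩).label).2
    have h6 : |(meet₁ ⟨a, 0⟩ ⟨b, d⟩).rank - (meet₂ ⟨a, 0⟩ ⟨b, d⟩).rank| ≤ 2 := by
      unfold meet₁ meet₂ incFst incSnd
      split_ifs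
      · have := (hi (vec a b)).1
        simp only [rank, add_sub_add_right_eq_sub]
        exact this
      · have := (hi (vec a b)).2
        rw [abs_le] at this ⊢
        simp only [rank]
        constructor <;> linarith
    have h7 : AffineLabel.rank ⟨a, 0⟩ = baseRank a := by simp [rank]
    have h8 : AffineLabel.rank ⟨b, d⟩ = baseRank b + 8 * d := rfl
    rw [abs_le] at h6
    simp only [Below, abs_le, abs_lt]
    omega

theorem sq_meet_lt {x y : AffineLabel} (h : sgn x.label y.label ≠ 0)
    (hxy : Below x y ∨ Below y x) :
    (meet₁ x y).rank ^ 2 + (meet₂ x y).rank ^ 2 < x.rank ^ 2 + y.rank ^ 2 := by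
  have key : ∀ {x y : AffineLabel}, sgn x.label y.label ≠ 0 → Below x y →
      (meet₁ x y).rank ^ 2 + (meet₂ x y).rank ^ 2 < x.rank ^ 2 + y.rank ^ 2 := by
    intro x y h hxy
    have h1 := rank_meet_add h
    have h2 := sq_lt_sq' (neg_lt.2 (lt_of_le_of_lt (neg_le_abs _) (meet_between h hxy).2.2))
      (lt_of_le_of_lt (le_abs_self _) (meet_between h hxy).2.2)
    have h3 : ((meet₁ x y).rank + (meet₂ x y).rank) ^ 2 = (x.rank + y.rank) ^ 2 := by rw [h1]
    nlinarith
  rcases hxy with hxy | hxy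
  · exact key h hxy
  · rw [meet₁_comm, meet₂_comm, add_comm (x.rank ^ 2)]
    rw [sgn_comm] at h
    exact key h hxy

/-- An incomparable pair whose product occurs in a quadric is the pair of its weight. -/
theorem meet_of_incomparable {x y : AffineLabel} (h : sgn x.label y.label ≠ 0)
    (hxy : ¬ Below x y) (hyx : ¬ Below y x) :
    (meet₁ x y = x ∧ meet₂ x y = y) ∨ (meet₁ x y = y ∧ meet₂ x y = x) := by
  have key : ∀ a b, ∀ d ∈ Finset.Icc (-2 : ℤ) 2, sgn a b ≠ 0 → ¬ Below ⟨a, 0⟩ ⟨b, d⟩ →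
      ¬ Below ⟨b, d⟩ ⟨a, 0⟩ →
      (meet₁ ⟨a, 0⟩ ⟨b, d⟩ = ⟨a, 0⟩ ∧ meet₂ ⟨a, 0⟩ ⟨b, d⟩ = ⟨b, d⟩) ∨
      (meet₁ ⟨a, 0⟩ ⟨b, d⟩ = ⟨b, d⟩ ∧ meet₂ ⟨a, 0⟩ ⟨b, d⟩ = ⟨a, 0⟩) := by decide +kernel
  have hb : ∀ a, (0 ≤ baseRank a ∧ baseRank a ≤ 10) ∧ -2 ≤ diff a ∧ diff a ≤ 2 := by
    decide +kernel
  have hx : x = shift x.level ⟨x.label, 0⟩ := by simp [shift]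
  have hy : y = shift x.level ⟨y.label, y.level - x.level⟩ := by simp [shift]
  have hk : x.level + y.level = (0 + (y.level - x.level)) + 2 * x.level := by ring
  have h1 : meet₁ x y = shift x.level (meet₁ ⟨x.label, 0⟩ ⟨y.label, y.level - x.level⟩) := by
    rw [meet₁, hk, incFst_add]
  have h2 : meet₂ x y = shift x.level (meet₂ ⟨x.label, 0⟩ ⟨y.label, y.level - x.level⟩) := by
    rw [meet₂, hk, incSnd_add]
  have hd : y.level - x.level ∈ Finset.Icc (-2 : ℤ) 2 := by
    have h3 := hb x.label
    have h4 := hb y.label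
    rw [Below, abs_le] at hxy hyx
    simp only [rank] at hxy hyx
    rw [Finset.mem_Icc]
    omega
  have h5 := key x.label y.label _ hd h
    (by rw [← below_shift (m := x.level), ← hx, ← hy]; exact hxy)
    (by rw [← below_shift (m := x.level), ← hx, ← hy]; exact hyx)
  rw [← shift_eq_iff (m := x.level), ← shift_eq_iff (m := x.level) (x := meet₂ _ _),
    ← shift_eq_iff (m := x.level) (x := meet₁ _ _) (y := ⟨y.label, _⟩),
    ← shift_eq_iff (m := x.level) (x := meet₂ _ _) (y := ⟨x.label, _⟩), ← h1, ← h2, ← hx, ← hy] at h5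
  exact h5

theorem sgn_ne_zero_of_incomparable {x y : AffineLabel} (hxy : ¬ Below x y)
    (hyx : ¬ Below y x) : sgn x.label y.label ≠ 0 := by
  have key : ∀ a b, ∀ d ∈ Finset.Icc (-2 : ℤ) 2, ¬ Below ⟨a, 0⟩ ⟨b, d⟩ → ¬ Below ⟨b, d⟩ ⟨a, 0⟩ →
      sgn a b ≠ 0 := by decide +kernel
  have hb : ∀ a, (0 ≤ baseRank a ∧ baseRank a ≤ 10) ∧ -2 ≤ diff a ∧ diff a ≤ 2 := by
    decide +kernel
  have hx : x = shift x.level ⟨x.label, 0⟩ := by simp [shift]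
  have hy : y = shift x.level ⟨y.label, y.level - x.level⟩ := by simp [shift]
  have hd : y.level - x.level ∈ Finset.Icc (-2 : ℤ) 2 := by
    have h3 := hb x.label
    have h4 := hb y.label
    rw [Below, abs_le] at hxy hyx
    simp only [rank] at hxy hyx
    rw [Finset.mem_Icc]
    omega
  exact key x.label y.label _ hd
    (by rw [← below_shift (m := x.level), ← hx, ← hy]; exact hxy)
    (by rw [← below_shift (m := x.level), ← hx, ← hy]; exact hyx)

theorem Below.refl (x : AffineLabel) : Below x x := by simp [Below]

theorem Below.trans {x y z : AffineLabel} (h : Below x y) (h' : Below y z) : Below x z := by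
  unfold Below at *
  have := abs_sub_le (diff z.label) (diff y.label) (diff x.label)
  linarith

end AffineLabel

/-! ### Jacobi identities in degree three -/

namespace AffineLabel

open SpinorLabel

/-- For every spinor label `δ` and every integer `t` there is one triple of labels of weight
`(δ, t)` in which one member is incomparable with the two others and forms with each of them a
product occurring in a quadric. This is the table of one of these two products, for
`t = 0, 1, 2`, as a quadric and a power of `z`. -/
def groundTable : SpinorLabel →
    ((Fin 5 ⊕ Fin 5) × ℤ) × ((Fin 5 ⊕ Fin 5) × ℤ) × ((Fin 5 ⊕ Fin 5) × ℤ)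
  | s0 => ((.inr 3, 0), (.inr 0, 1), (.inr 0, 2))
  | s12 => ((.inr 2, 0), (.inl 0, 1), (.inl 1, 2))
  | s13 => ((.inr 1, 0), (.inl 0, 1), (.inl 2, 2))
  | s14 => ((.inr 1, 0), (.inl 0, 1), (.inl 3, 2))
  | s15 => ((.inl 0, 0), (.inl 0, 1), (.inl 4, 2))
  | s23 => ((.inr 0, 0), (.inl 1, 1), (.inr 3, 1))
  | s24 => ((.inr 0, 0), (.inl 1, 1), (.inr 2, 1))
  | s25 => ((.inl 1, 0), (.inl 1, 1), (.inr 2, 1))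
  | s34 => ((.inr 0, 0), (.inl 2, 1), (.inr 1, 1))
  | s35 => ((.inl 2, 0), (.inl 2, 1), (.inr 1, 1))
  | s45 => ((.inl 3, 0), (.inl 3, 1), (.inr 1, 1))
  | s1 => ((.inl 3, 0), (.inl 4, 1), (.inl 1, 1))
  | s2 => ((.inl 2, 0), (.inl 4, 1), (.inl 0, 1))
  | s3 => ((.inl 1, 0), (.inl 4, 1), (.inl 0, 1))
  | s4 => ((.inl 1, 0), (.inl 4, 1), (.inl 0, 1))
  | s5 => ((.inl 0, 0), (.inl 3, 1), (.inl 0, 1))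

/-- The vector weight of the ground triple of weight `(δ, t)`; raising `t` by three raises all
three levels by one. -/
def groundVec (δ : SpinorLabel) (t : ℤ) : (Fin 5 ⊕ Fin 5) × ℤ :=
  let e := if t % 3 = 0 then (groundTable δ).1 else
    if t % 3 = 1 then (groundTable δ).2.1 else (groundTable δ).2.2
  (e.1, e.2 + 2 * (t / 3))

/-- The vector weight `(s, k)` and the label `x` are the chosen product and the remaining label of
a ground triple. -/
def IsGround (s : Fin 5 ⊕ Fin 5) (k : ℤ) (x : AffineLabel) : Prop :=
  coef (dual s) x.label ≠ 0 ∧ groundVec (mate (dual s) x.label) (k + x.level) = (s, k)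

instance (s : Fin 5 ⊕ Fin 5) (k : ℤ) (x : AffineLabel) : Decidable (IsGround s k x) :=
  inferInstanceAs (Decidable (_ ∧ _))

theorem isGround_shift {s : Fin 5 ⊕ Fin 5} {k : ℤ} {x : AffineLabel} (m : ℤ) :
    IsGround s (k + 2 * m) (shift m x) ↔ IsGround s k x := by
  have h1 : (k + 2 * m + (x.level + m)) % 3 = (k + x.level) % 3 := by omega
  have h2 : (k + 2 * m + (x.level + m)) / 3 = (k + x.level) / 3 + m := by omega
  simp only [IsGround, groundVec, shift, h1, h2, Prod.mk.injEq]
  constructor <;> rintro ⟨h₀, h, h'⟩ <;> exact ⟨h₀, h, by linarith⟩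

/-- If a label `x` is incomparable with a member `y` of an incomparable pair `y`, `z`, then the
triple is the ground triple of its weight, unless `x = z`. -/
theorem isGround_of_incomparable {s : Fin 5 ⊕ Fin 5} {k : ℤ} {x y z : AffineLabel}
    (hyz : (y = incFst s k ∧ z = incSnd s k) ∨ (y = incSnd s k ∧ z = incFst s k))
    (hs : sgn y.label x.label ≠ 0) (hxy : ¬ Below x y) (hyx : ¬ Below y x) :
    x = z ∨ IsGround (vec y.label x.label) (y.level + x.level) z ∨ IsGround s k x := by
  have key : ∀ s, ∀ e ∈ Finset.Icc (0 : ℤ) 1, ∀ a, ∀ d ∈ Finset.Icc (-2 : ℤ) 3,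
      ∀ p ∈ [(incFst s e, incSnd s e), (incSnd s e, incFst s e)],
      sgn p.1.label a ≠ 0 → ¬ Below ⟨a, d⟩ p.1 → ¬ Below p.1 ⟨a, d⟩ →
      ⟨a, d⟩ = p.2 ∨ IsGround (vec p.1.label a) (p.1.level + d) p.2 ∨ IsGround s e ⟨a, d⟩ := by
    decide +kernel
  have hb : ∀ a, (0 ≤ baseRank a ∧ baseRank a ≤ 10) ∧ -2 ≤ diff a ∧ diff a ≤ 2 := by
    decide +kernel
  obtain ⟨m, e, he, rfl⟩ : ∃ m e : ℤ, e ∈ Finset.Icc (0 : ℤ) 1 ∧ k = e + 2 * m :=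
    ⟨k / 2, k % 2, by rw [Finset.mem_Icc]; omega, by omega⟩
  have hx : x = shift m ⟨x.label, x.level - m⟩ := by simp [shift]
  have hy' : (incFst s e).level = 0 ∨ (incFst s e).level = 1 := by
    rw [Finset.mem_Icc] at he
    unfold incFst
    split_ifs <;> simp only <;> omega
  have hz' : (incSnd s e).level = 0 := by
    rw [Finset.mem_Icc] at he
    unfold incSnd
    split_ifs <;> simp only <;> omega
  rw [incFst_add, incSnd_add] at hyz
  have main : ∀ p ∈ [(incFst s e, incSnd s e), (incSnd s e, incFst s e)],
      y = shift m p.1 → z = shift m p.2 → (p.1.level = 0 ∨ p.1.level = 1) →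
      x = z ∨ IsGround (vec y.label x.label) (y.level + x.level) z ∨
        IsGround s (e + 2 * m) x := by
    rintro ⟨p₁, p₂⟩ hp rfl rfl hl
    simp only at hl ⊢
    have hd : x.level - m ∈ Finset.Icc (-2 : ℤ) 3 := by
      have h3 := hb x.label
      have h4 := hb p₁.label
      rw [Below, abs_le] at hxy hyx
      simp only [rank, shift] at hxy hyx
      rw [Finset.mem_Icc]
      omega
    have h5 := key s e he x.label _ hd _ hp hs
      (by rw [← below_shift (m := m), ← hx]; exact hxy)
      (by rw [← below_shift (m := m), ← hx]; exact hyx)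
    rw [← shift_eq_iff (m := m), ← isGround_shift m, ← isGround_shift m (x := ⟨x.label, _⟩),
      ← hx] at h5
    have h6 : (shift m p₁).level + x.level = p₁.level + (x.level - m) + 2 * m := by
      simp only [shift]; ring
    rw [h6]
    exact h5
  rcases hyz with ⟨h1, h2⟩ | ⟨h1, h2⟩
  · exact main (incFst s e, incSnd s e) (by simp) h1 h2 hy'
  · exact main (incSnd s e, incFst s e) (by simp) h1 h2 (Or.inl hz')

section

variable {M : Type*} [AddCommGroup M] (F : AffineLabel → AffineLabel → AffineLabel → M)

/-- The sum of squares of ranks, the first termination measure. -/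
def sqRank (x y z : AffineLabel) : ℤ := x.rank ^ 2 + y.rank ^ 2 + z.rank ^ 2

/-- The coefficient of the incomparable pair in the anticommutator of two generators. -/
def relCoef (x y : AffineLabel) : ℤ :=
  sgn x.label y.label * sgn (meet₁ x y).label (meet₂ x y).label

theorem relCoef_comm (x y : AffineLabel) : relCoef x y = relCoef y x := by
  rw [relCoef, relCoef, meet₁_comm, meet₂_comm, sgn_comm x.label]

/-- The function `F` on words of three letters respects the relation between the generators `x`
and `y` with a third letter `z` on either side. -/
def RespectsRel (x y z : AffineLabel) : Prop :=
  F x y z + F y x z =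
      relCoef x y • (F (meet₁ x y) (meet₂ x y) z + F (meet₂ x y) (meet₁ x y) z) ∧
    F z x y + F z y x =
      relCoef x y • (F z (meet₁ x y) (meet₂ x y) + F z (meet₂ x y) (meet₁ x y))

/-- The function `F` respects all relations between words of square rank less than `q`. -/
def RespectsBelow (q : ℤ) : Prop := ∀ x y z, sqRank x y z < q → RespectsRel F x y z

/-- The value of `F` on the commutator of `A_(s,k)` with the generator `x`, where `A_(s,k)` is
the signed anticommutator of the incomparable pair of weight `(s, k)`. -/
def vecComm (s : Fin 5 ⊕ Fin 5) (k : ℤ) (x : AffineLabel) : M :=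
  sgn (incFst s k).label (incSnd s k).label •
    (F (incFst s k) (incSnd s k) x + F (incSnd s k) (incFst s k) x -
      F x (incFst s k) (incSnd s k) - F x (incSnd s k) (incFst s k))

/-- The value of `F` on the commutator of `{x, y}` with `z`, by the relation between `x` and
`y`. -/
def bracketComm (x y z : AffineLabel) : M :=
  sgn x.label y.label • vecComm F (vec x.label y.label) (x.level + y.level) z

variable {F}

theorem RespectsRel.bracketComm_eq {x y z : AffineLabel} (h : RespectsRel F x y z) :
    bracketComm F x y z = F x y z + F y x z - F z x y - F z y x := by
  have h1 := h.1
  have h2 := h.2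
  rw [sub_sub, h1, h2, bracketComm, vecComm, smul_smul]
  rw [← relCoef, ← smul_sub, sub_sub]

/-- The Jacobi identity, for words to which the relations apply. -/
theorem RespectsBelow.jacobi {q : ℤ} (h : RespectsBelow F q) {x y z : AffineLabel}
    (hq : sqRank x y z < q) :
    bracketComm F x y z + bracketComm F x z y + bracketComm F y z x = 0 := by
  have h1 : sqRank x z y < q := by unfold sqRank at hq ⊢; linarith
  have h2 : sqRank y z x < q := by unfold sqRank at hq ⊢; linarith
  rw [(h x y z hq).bracketComm_eq, (h x z y h1).bracketComm_eq, (h y z x h2).bracketComm_eq]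
  abel

variable (F)

/-- The value of `F` on the element of weight `(δ, t)` in degree three, normalized at the ground
triple. -/
def groundValue (δ : SpinorLabel) (t : ℤ) : M :=
  coef (dual (groundVec δ t).1) δ • vecComm F (groundVec δ t).1 (groundVec δ t).2
    ⟨mate (dual (groundVec δ t).1) δ, t - (groundVec δ t).2⟩

/-- The difference between a commutator and the multiple of a ground value that it is to be. -/
def commGap (s : Fin 5 ⊕ Fin 5) (k : ℤ) (x : AffineLabel) : M :=
  vecComm F s k x - coef (dual s) x.label • groundValue F (mate (dual s) x.label) (k + x.level)

/-- The contribution of the pair `x`, `y` to the Jacobi identity for the gaps. -/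
def bracketGap (x y z : AffineLabel) : M :=
  sgn x.label y.label • commGap F (vec x.label y.label) (x.level + y.level) z

variable {F}

theorem fierz_smul (g : SpinorLabel → M) (a b c : SpinorLabel) :
    (sgn a b * coef (dual (vec a b)) c) • g (mate (dual (vec a b)) c) +
      (sgn a c * coef (dual (vec a c)) b) • g (mate (dual (vec a c)) b) +
      (sgn b c * coef (dual (vec b c)) a) • g (mate (dual (vec b c)) a) = 0 := by
  obtain ⟨h1, h2, h3, h4⟩ := fierz a b c
  generalize sgn a b * coef (dual (vec a b)) c = k₁ at *
  generalize sgn a c * coef (dual (vec a c)) b = k₂ at *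
  generalize sgn b c * coef (dual (vec b c)) a = k₃ at *
  by_cases e1 : k₁ = 0
  · by_cases e2 : k₂ = 0
    · have e3 : k₃ = 0 := by omega
      simp [e1, e2, e3]
    · have e3 : k₃ = -k₂ := by omega
      rw [h3 e2 (by omega), e1, e3]
      simp
  · by_cases e2 : k₂ = 0
    · have e3 : k₃ = -k₁ := by omega
      rw [h2 e1 (by omega), e2, e3]
      simp
    · rw [h1 e1 e2]
      by_cases e3 : k₃ = 0
      · have e4 : k₂ = -k₁ := by omega
        rw [e3, e4]
        simp
      · rw [← h3 e2 e3, ← add_smul, ← add_smul, h4, zero_smul]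

theorem bracketGap_add (x y z : AffineLabel) :
    bracketGap F x y z + bracketGap F x z y + bracketGap F y z x =
      bracketComm F x y z + bracketComm F x z y + bracketComm F y z x := by
  have h := fierz_smul (fun δ => groundValue F δ (x.level + y.level + z.level))
    x.label y.label z.label
  have h1 : x.level + z.level + y.level = x.level + y.level + z.level := by ring
  have h2 : y.level + z.level + x.level = x.level + y.level + z.level := by ring
  unfold bracketGap bracketComm commGap
  rw [h1, h2]
  simp only [mul_smul] at h
  simp only [smul_sub]
  rw [← sub_eq_zero, ← neg_eq_zero, ← h]
  abel

theorem IsGround.commGap_eq_zero {s : Fin 5 ⊕ Fin 5} {k : ℤ} {x : AffineLabel}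
    (h : IsGround s k x) : commGap F s k x = 0 := by
  obtain ⟨hc, h⟩ := h
  rw [commGap, groundValue, h, smul_smul]
  simp only
  rw [coef_mate, mate_mate, coef_mul_self _ _ hc, add_sub_cancel_left, one_smul, sub_self]

theorem sqRank_meet_lt {x y : AffineLabel} (h : sgn x.label y.label ≠ 0)
    (hxy : Below x y ∨ Below y x) (z : AffineLabel) :
    sqRank (meet₁ x y) (meet₂ x y) z < sqRank x y z := by
  have := sq_meet_lt h hxy
  unfold sqRank
  linarith

/-- In degree three the commutators are multiples of the ground values, as far as the relations
apply. -/
theorem RespectsBelow.commGap_eq_zero [IsAddTorsionFree M] {q : ℤ} (h : RespectsBelow F q)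
    {s : Fin 5 ⊕ Fin 5} {k : ℤ} {x : AffineLabel}
    (hq : sqRank (incFst s k) (incSnd s k) x < q) : commGap F s k x = 0 := by
  obtain ⟨n, hn⟩ : ∃ n : ℕ, (sqRank (incFst s k) (incSnd s k) x).toNat = n := ⟨_, rfl⟩
  induction n using Nat.strong_induction_on generalizing s k x with
  | _ n ih =>
  set σ := incFst s k with hσ
  set τ := incSnd s k with hτ
  have hη := sgn_inc_mul_self s k
  rw [← hσ, ← hτ] at hη
  have hJ : sgn σ.label τ.label • commGap F s k x + bracketGap F σ x τ + bracketGap F τ x σ =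
      0 := by
    have h1 := bracketGap_add (F := F) σ τ x
    rw [h.jacobi hq] at h1
    rw [← h1, bracketGap.eq_def F σ τ x, hσ, hτ, vec_inc, inc_level_add]
  -- Each of the last two terms vanishes or is a multiple of the first.
  have key : ∀ y z, ((y = σ ∧ z = τ) ∨ (y = τ ∧ z = σ)) → commGap F s k x = 0 ∨
      bracketGap F y x z = 0 ∨
      (x = z ∧ bracketGap F y x z = sgn σ.label τ.label • commGap F s k x) := by
    intro y z hyz
    by_cases hs : sgn y.label x.label = 0
    · right; left
      rw [bracketGap, hs, zero_smul]
    by_cases hxz : x = z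
    · right; right
      refine ⟨hxz, ?_⟩
      rcases hyz with ⟨rfl, rfl⟩ | ⟨rfl, rfl⟩
      · rw [bracketGap, hxz, hσ, hτ, vec_inc, inc_level_add]
      · rw [bracketGap, hxz, hσ, hτ, sgn_comm, vec_comm, add_comm, vec_inc, inc_level_add]
    have hQ : sqRank y x z = sqRank σ τ x := by
      rcases hyz with ⟨rfl, rfl⟩ | ⟨rfl, rfl⟩ <;> unfold sqRank <;> ring
    by_cases hc : Below x y ∨ Below y x
    · right; left
      have hlt := sqRank_meet_lt hs hc.symm z
      rw [hQ] at hlt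
      have h0 : 0 ≤ sqRank (meet₁ y x) (meet₂ y x) z := by unfold sqRank; positivity
      rw [bracketGap, ih _ ((Int.toNat_lt_toNat (h0.trans_lt hlt)).2 hlt |>.trans_eq hn) (hlt.trans hq) rfl, smul_zero]
    · rw [not_or] at hc
      rcases isGround_of_incomparable hyz hs hc.1 hc.2 with h3 | h3 | h3
      · exact absurd h3 hxz
      · right; left
        rw [bracketGap, h3.commGap_eq_zero, smul_zero]
      · left
        exact h3.commGap_eq_zero
  have hz : sgn σ.label τ.label • commGap F s k x = 0 := by
    rcases key σ τ (Or.inl ⟨rfl, rfl⟩) with h1 | h1 | ⟨h1, h1'⟩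
    · rw [h1, smul_zero]
    · rcases key τ σ (Or.inr ⟨rfl, rfl⟩) with h2 | h2 | ⟨h2, h2'⟩
      · rw [h2, smul_zero]
      · rwa [h1, h2, add_zero, add_zero] at hJ
      · rw [h1, h2', add_zero, ← two_nsmul] at hJ
        exact (smul_eq_zero_iff_right (two_ne_zero)).1 hJ
    · rcases key τ σ (Or.inr ⟨rfl, rfl⟩) with h2 | h2 | ⟨h2, h2'⟩
      · rw [h2, smul_zero]
      · rw [h1', h2, add_zero, ← two_nsmul] at hJ
        exact (smul_eq_zero_iff_right (two_ne_zero)).1 hJ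
      · exfalso
        rw [← h1, h2, sgn_self] at hη
        simp at hη
  have := congrArg (sgn σ.label τ.label • ·) hz
  simpa only [smul_smul, hη, one_smul, smul_zero] using this

/-- The Jacobi identity for a triple of pairwise comparable labels follows from the relations
between words of smaller square rank. -/
theorem RespectsBelow.jacobi_of_comparable [IsAddTorsionFree M] {x y z : AffineLabel}
    (h : RespectsBelow F (sqRank x y z)) (hxy : Below x y ∨ Below y x)
    (hxz : Below x z ∨ Below z x) (hyz : Below y z ∨ Below z y) :
    bracketComm F x y z + bracketComm F x z y + bracketComm F y z x = 0 := by
  have key : ∀ x' y' z', sqRank x' y' z' = sqRank x y z → (Below x' y' ∨ Below y' x') →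
      bracketGap F x' y' z' = 0 := by
    intro x' y' z' hQ hc
    by_cases hs : sgn x'.label y'.label = 0
    · rw [bracketGap, hs, zero_smul]
    · rw [bracketGap, h.commGap_eq_zero (hQ ▸ sqRank_meet_lt hs hc z'), smul_zero]
  rw [← bracketGap_add, key x y z rfl hxy, key x z y (by unfold sqRank; ring) hxz,
    key y z x (by unfold sqRank; ring) hyz]
  simp

end

end AffineLabel

/-! ### Normal forms for confluent linear rewriting -/

noncomputable section

section Rewriting

variable {k W : Type*} [CommRing k] (Red : W → (W →₀ k) → Prop) (r : W → W → Prop)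

/-- The span of the rewriting relations `v = p` for the words `v` smaller than `w`. -/
def relationsBelow (w : W) : Submodule k (W →₀ k) :=
  Submodule.span k {t | ∃ v p, r v w ∧ Red v p ∧ t = Finsupp.single v 1 - p}

variable {Red r}

/-- The diamond lemma for linear rewriting: if any two reductions of a word differ by relations
between smaller words, then there is a normal form that respects all reductions. -/
theorem exists_normalForm (hwf : WellFounded r)
    (hr : ∀ w p, Red w p → ∀ v ∈ p.support, r v w)
    (hres : ∀ w p p', Red w p → Red w p' → p - p' ∈ relationsBelow Red r w) :
    ∃ nf : W → (W →₀ k), (∀ w p, Red w p → nf w = Finsupp.linearCombination k nf p) ∧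
      ∀ w, (∀ p, ¬ Red w p) → nf w = Finsupp.single w 1 := by
  classical
  let nf : W → (W →₀ k) := hwf.fix fun w ih =>
    if h : ∃ p, Red w p then
      ∑ v ∈ h.choose.support.attach, h.choose v.1 • ih v.1 (hr w _ h.choose_spec _ v.2)
    else Finsupp.single w 1
  have hnf : ∀ w, nf w = if h : ∃ p, Red w p then Finsupp.linearCombination k nf h.choose
      else Finsupp.single w 1 := by
    intro w
    rw [show nf w = _ from hwf.fix_eq _ w]
    split_ifs with h
    · rw [Finsupp.linearCombination_apply, Finsupp.sum]
      exact Finset.sum_attach h.choose.support fun v => h.choose v • nf v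
    · rfl
  refine ⟨nf, fun w => ?_, fun w h => by rw [hnf, dif_neg (not_exists.2 h)]⟩
  induction w using hwf.induction with
  | _ w ih =>
  intro p hp
  have h : ∃ p, Red w p := ⟨p, hp⟩
  rw [hnf, dif_pos h, ← sub_eq_zero, ← map_sub]
  refine Submodule.span_induction (p := fun t _ => Finsupp.linearCombination k nf t = 0)
    ?_ (map_zero _) (fun _ _ _ _ h h' => by rw [map_add, h, h', add_zero])
    (fun _ _ _ h => by rw [map_smul, h, smul_zero]) (hres w _ _ h.choose_spec hp)
  rintro _ ⟨v, q, hv, hq, rfl⟩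
  rw [map_sub, Finsupp.linearCombination_single, one_smul, ih v hv q hq, sub_self]

/-- A linear map that respects the reductions of a class of words closed under reduction does not
distinguish a word of this class from its normal form. -/
theorem map_normalForm {N : Type*} [AddCommGroup N] [Module k N] (hwf : WellFounded r)
    (hr : ∀ w p, Red w p → ∀ v ∈ p.support, r v w) {nf : W → (W →₀ k)}
    (hnf : ∀ w p, Red w p → nf w = Finsupp.linearCombination k nf p)
    (hnf' : ∀ w, (∀ p, ¬ Red w p) → nf w = Finsupp.single w 1)
    (S : (W →₀ k) →ₗ[k] N) (P : W → Prop)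
    (hP : ∀ w p, P w → Red w p → ∀ v ∈ p.support, P v)
    (hS : ∀ w p, P w → Red w p → S (Finsupp.single w 1) = S p) {w : W} (hw : P w) :
    S (nf w) = S (Finsupp.single w 1) := by
  induction w using hwf.induction with
  | _ w ih =>
  by_cases h : ∃ p, Red w p
  · obtain ⟨p, hp⟩ := h
    rw [hnf w p hp, hS w p hw hp, Finsupp.linearCombination_apply, Finsupp.sum, map_sum]
    conv_rhs => rw [← Finsupp.sum_single p, Finsupp.sum, map_sum]
    refine Finset.sum_congr rfl fun v hv => ?_
    rw [map_smul, ih v (hr w p hp v hv) (hP w p hw hp v hv), ← map_smul, Finsupp.smul_single,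
      smul_eq_mul, mul_one]
  · rw [hnf' w (not_exists.1 h)]

end Rewriting

/-! ### The rewriting system on words in `Ê` -/

namespace AffineLabel

open SpinorLabel

/-- The sum of the squares of the ranks of the letters. -/
def wordSq (w : List AffineLabel) : ℕ := (w.map fun x => x.rank.natAbs ^ 2).sum

/-- The number of pairs of letters of which the first has the greater rank. -/
def inversions : List AffineLabel → ℕ
  | [] => 0
  | x :: w => w.countP (fun y => y.rank < x.rank) + inversions w

/-- The lexicographic order by sum of squares of ranks and number of inversions. -/
def WordLT (v w : List AffineLabel) : Prop :=
  Prod.Lex (· < ·) (· < ·) (wordSq v, inversions v) (wordSq w, inversions w)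

theorem wordLT_wf : WellFounded WordLT :=
  InvImage.wf (fun w => (wordSq w, inversions w)) (WellFounded.prod_lex Nat.lt_wfRel.wf Nat.lt_wfRel.wf)

theorem WordLT.trans {u v w : List AffineLabel} (h : WordLT u v) (h' : WordLT v w) :
    WordLT u w := by
  unfold WordLT at *
  rw [Prod.lex_def] at *
  simp only at *
  omega

theorem wordSq_append (u v : List AffineLabel) : wordSq (u ++ v) = wordSq u + wordSq v := by
  simp [wordSq]

theorem wordSq_cons (x : AffineLabel) (v : List AffineLabel) :
    wordSq (x :: v) = x.rank.natAbs ^ 2 + wordSq v := by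
  simp [wordSq]

theorem wordLT_of_wordSq_lt {v w : List AffineLabel} (h : wordSq v < wordSq w) : WordLT v w :=
  Prod.Lex.left _ _ h

theorem inversions_swap_lt (u v : List AffineLabel) {x y : AffineLabel} (h : y.rank < x.rank) :
    inversions (u ++ y :: x :: v) < inversions (u ++ x :: y :: v) := by
  induction u with
  | nil =>
    simp only [List.nil_append, inversions, List.countP_cons, h, h.not_gt, decide_true,
      decide_false, if_true]
    simp only [Bool.false_eq_true, if_false]
    omega
  | cons z u ih =>
    simp only [List.cons_append, inversions]
    have : (u ++ y :: x :: v).countP (fun y => decide (y.rank < z.rank)) =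
        (u ++ x :: y :: v).countP (fun y => decide (y.rank < z.rank)) :=
      List.Perm.countP_eq _ ((List.Perm.swap x y v).append_left u)
    omega

theorem wordLT_swap (u v : List AffineLabel) {x y : AffineLabel} (h : y.rank < x.rank) :
    WordLT (u ++ y :: x :: v) (u ++ x :: y :: v) := by
  have h1 : wordSq (u ++ y :: x :: v) = wordSq (u ++ x :: y :: v) := by
    simp only [wordSq_append, wordSq_cons]
    omega
  unfold WordLT
  rw [h1]
  exact Prod.Lex.right _ (inversions_swap_lt u v h)

/-- The right-hand side of the rewriting rule for the word `x y`, where `y ≤ x`. -/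
def pairReduct (x y : AffineLabel) : List AffineLabel →₀ ℂ :=
  if x = y then 0 else
    -Finsupp.single [y, x] 1 + relCoef x y •
      (Finsupp.single [meet₁ x y, meet₂ x y] 1 + Finsupp.single [meet₂ x y, meet₁ x y] 1)

theorem relCoef_ne_zero {x y : AffineLabel} (h : relCoef x y ≠ 0) : sgn x.label y.label ≠ 0 :=
  left_ne_zero_of_mul h

theorem relCoef_self (x : AffineLabel) : relCoef x x = 0 := by
  rw [relCoef, sgn_self, zero_mul]

theorem mem_support_pairReduct {x y : AffineLabel} {w : List AffineLabel}
    (h : w ∈ (pairReduct x y).support) :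
    (x ≠ y ∧ w = [y, x]) ∨ (relCoef x y ≠ 0 ∧
      (w = [meet₁ x y, meet₂ x y] ∨ w = [meet₂ x y, meet₁ x y])) := by
  by_contra hc
  rw [not_or, not_and, not_and] at hc
  rw [Finsupp.mem_support_iff, pairReduct] at h
  split_ifs at h with hxy
  · exact h rfl
  · apply h
    have h1 := hc.1 hxy
    by_cases h2 : relCoef x y = 0
    · simp [h2, Ne.symm h1]
    · have h3 := not_or.1 (hc.2 h2)
      simp [Ne.symm h1, Ne.symm h3.1, Ne.symm h3.2]

/-- The linear map that puts words between `u` and `v`. -/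
def inContext (u v : List AffineLabel) : (List AffineLabel →₀ ℂ) →ₗ[ℂ] (List AffineLabel →₀ ℂ) :=
  Finsupp.lmapDomain ℂ ℂ fun w => u ++ (w ++ v)

theorem inContext_single (u v w : List AffineLabel) (c : ℂ) :
    inContext u v (Finsupp.single w c) = Finsupp.single (u ++ (w ++ v)) c := by
  simp [inContext, Finsupp.lmapDomain_apply, Finsupp.mapDomain_single]

/-- One rewriting step, at two adjacent letters of which the second is at most the first. -/
inductive WordRed : List AffineLabel → (List AffineLabel →₀ ℂ) → Prop
  | mk (u v : List AffineLabel) {x y : AffineLabel} (h : Below y x) :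
      WordRed (u ++ x :: y :: v) (inContext u v (pairReduct x y))

theorem exists_of_mem_support_inContext {u v w : List AffineLabel}
    {p : List AffineLabel →₀ ℂ} (h : w ∈ (inContext u v p).support) :
    ∃ w' ∈ p.support, w = u ++ (w' ++ v) := by
  classical
  obtain ⟨w', h1, h2⟩ := Finset.mem_image.1 (Finsupp.mapDomain_support h)
  exact ⟨w', h1, h2.symm⟩

theorem wordLT_of_mem_pairReduct {x y : AffineLabel} (hyx : Below y x) {w : List AffineLabel}
    (hw : w ∈ (pairReduct x y).support) (u v : List AffineLabel) :
    WordLT (u ++ (w ++ v)) (u ++ x :: y :: v) := by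
  rcases mem_support_pairReduct hw with ⟨h, rfl⟩ | ⟨h, rfl | rfl⟩
  · exact wordLT_swap u v (hyx.rank_lt h.symm)
  all_goals
    apply wordLT_of_wordSq_lt
    have h1 := sq_meet_lt (relCoef_ne_zero h) (Or.inr hyx)
    zify
    simp only [List.cons_append, List.nil_append, wordSq_append, wordSq_cons]
    push_cast
    simp only [sq_abs]
    linarith

theorem wordRed_wordLT (w : List AffineLabel) (p : List AffineLabel →₀ ℂ) (h : WordRed w p) :
    ∀ v ∈ p.support, WordLT v w := by
  intro w' hw'
  obtain ⟨u, v, h⟩ := h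
  obtain ⟨w'', h1, rfl⟩ := exists_of_mem_support_inContext hw'
  exact wordLT_of_mem_pairReduct h h1 u v

/-- The words modulo the relations between words smaller than `w`. -/
abbrev wordClass (w : List AffineLabel) :
    (List AffineLabel →₀ ℂ) →ₗ[ℂ] (List AffineLabel →₀ ℂ) ⧸ relationsBelow WordRed WordLT w :=
  (relationsBelow WordRed WordLT w).mkQ

theorem wordClass_eq {w v : List AffineLabel} {p : List AffineLabel →₀ ℂ} (h : WordLT v w)
    (hp : WordRed v p) : wordClass w (Finsupp.single v 1) = wordClass w p := by
  rw [← sub_eq_zero, ← map_sub, Submodule.mkQ_apply, Submodule.Quotient.mk_eq_zero]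
  exact Submodule.subset_span ⟨v, p, h, hp, rfl⟩

theorem map_inContext_pairReduct {N : Type*} [AddCommGroup N] [Module ℂ N]
    (S : (List AffineLabel →₀ ℂ) →ₗ[ℂ] N) (u v : List AffineLabel) {x y : AffineLabel}
    (hxy : x ≠ y) : S (inContext u v (pairReduct x y)) =
      -S (Finsupp.single (u ++ y :: x :: v) 1) + relCoef x y •
        (S (Finsupp.single (u ++ meet₁ x y :: meet₂ x y :: v) 1) +
          S (Finsupp.single (u ++ meet₂ x y :: meet₁ x y :: v) 1)) := by
  rw [pairReduct, if_neg hxy]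
  simp only [map_add, map_neg, map_zsmul, inContext_single]
  rfl

theorem map_inContext_pairReduct_self {N : Type*} [AddCommGroup N] [Module ℂ N]
    (S : (List AffineLabel →₀ ℂ) →ₗ[ℂ] N) (u v : List AffineLabel) (x : AffineLabel) :
    S (inContext u v (pairReduct x x)) = 0 := by
  rw [pairReduct, if_pos rfl, map_zero, map_zero]

/-- A map that respects the rewriting step at `x y` or at `y x` respects the relation between
`x` and `y`; for incomparable labels the relation is trivial. -/
theorem anticomm_of_respects {N : Type*} [AddCommGroup N] [Module ℂ N]
    (S : (List AffineLabel →₀ ℂ) →ₗ[ℂ] N) (u v : List AffineLabel) (x y : AffineLabel)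
    (h : Below y x → S (Finsupp.single (u ++ x :: y :: v) 1) = S (inContext u v (pairReduct x y)))
    (h' : Below x y →
      S (Finsupp.single (u ++ y :: x :: v) 1) = S (inContext u v (pairReduct y x))) :
    S (Finsupp.single (u ++ x :: y :: v) 1) + S (Finsupp.single (u ++ y :: x :: v) 1) =
      relCoef x y • (S (Finsupp.single (u ++ meet₁ x y :: meet₂ x y :: v) 1) +
        S (Finsupp.single (u ++ meet₂ x y :: meet₁ x y :: v) 1)) := by
  by_cases hxy : x = y
  · subst hxy
    rw [h (Below.refl x), map_inContext_pairReduct_self, relCoef_self, zero_smul, add_zero]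
  by_cases h1 : Below y x
  · rw [h h1, map_inContext_pairReduct S u v hxy]
    abel
  by_cases h2 : Below x y
  · rw [h' h2, map_inContext_pairReduct S u v (Ne.symm hxy), relCoef_comm y x, meet₁_comm y x,
      meet₂_comm y x]
    abel
  · have h3 := sgn_ne_zero_of_incomparable h2 h1
    rcases meet_of_incomparable h3 h2 h1 with ⟨h4, h5⟩ | ⟨h4, h5⟩
    · rw [relCoef, h4, h5, sgn_mul_self _ _ h3, one_smul]
    · rw [relCoef, h4, h5, sgn_comm y.label, sgn_mul_self _ _ h3, one_smul, add_comm]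

theorem bracketComm_eq_relCoef {M : Type*} [AddCommGroup M]
    (F : AffineLabel → AffineLabel → AffineLabel → M) (x y z : AffineLabel) :
    bracketComm F x y z = relCoef x y • (F (meet₁ x y) (meet₂ x y) z + F (meet₂ x y) (meet₁ x y) z)
      - relCoef x y • (F z (meet₁ x y) (meet₂ x y) + F z (meet₂ x y) (meet₁ x y)) := by
  rw [bracketComm, vecComm, smul_smul, ← relCoef, ← smul_sub, sub_sub]

/-- Overlapping rewriting steps are confluent. -/
theorem wordClass_overlap (u v : List AffineLabel) {x y z : AffineLabel} (hyx : Below y x)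
    (hzy : Below z y) :
    wordClass (u ++ x :: y :: z :: v) (inContext u (z :: v) (pairReduct x y)) =
      wordClass (u ++ x :: y :: z :: v) (inContext (u ++ [x]) v (pairReduct y z)) := by
  set w := u ++ x :: y :: z :: v with hw
  have : IsAddTorsionFree ((List AffineLabel →₀ ℂ) ⧸ relationsBelow WordRed WordLT w) :=
    let _ : Module ℚ ((List AffineLabel →₀ ℂ) ⧸ relationsBelow WordRed WordLT w) :=
      Module.compHom _ (algebraMap ℚ ℂ)
    .of_module_rat _
  let F : AffineLabel → AffineLabel → AffineLabel →
      (List AffineLabel →₀ ℂ) ⧸ relationsBelow WordRed WordLT w :=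
    fun a b c => wordClass w (Finsupp.single (u ++ a :: b :: c :: v) 1)
  have hF : ∀ a b c, F a b c = wordClass w (Finsupp.single ((u ++ [a]) ++ b :: c :: v) 1) := by
    intro a b c
    simp [F]
  -- The relations for words smaller than `w`.
  have left : ∀ a b c, WordLT (u ++ a :: b :: c :: v) w → WordLT (u ++ b :: a :: c :: v) w →
      F a b c + F b a c =
        relCoef a b • (F (meet₁ a b) (meet₂ a b) c + F (meet₂ a b) (meet₁ a b) c) :=
    fun a b c h h' => anticomm_of_respects (wordClass w) u (c :: v) a b
      (fun hb => wordClass_eq h (WordRed.mk u (c :: v) hb))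
      (fun hb => wordClass_eq h' (WordRed.mk u (c :: v) hb))
  have right : ∀ a b c, WordLT (u ++ c :: a :: b :: v) w → WordLT (u ++ c :: b :: a :: v) w →
      F c a b + F c b a =
        relCoef a b • (F c (meet₁ a b) (meet₂ a b) + F c (meet₂ a b) (meet₁ a b)) := by
    intro a b c h h'
    simp only [hF]
    exact anticomm_of_respects (wordClass w) (u ++ [c]) v a b
      (fun hb => wordClass_eq (by simpa using h) (WordRed.mk (u ++ [c]) v hb))
      (fun hb => wordClass_eq (by simpa using h') (WordRed.mk (u ++ [c]) v hb))
  have hsq : ∀ a b c, sqRank a b c < sqRank x y z → WordLT (u ++ a :: b :: c :: v) w := by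
    intro a b c h
    apply wordLT_of_wordSq_lt
    unfold sqRank at h
    zify
    simp only [hw, wordSq_append, wordSq_cons]
    push_cast
    simp only [sq_abs]
    linarith
  have hq : RespectsBelow F (sqRank x y z) := by
    intro a b c h
    exact ⟨left a b c (hsq a b c h) (hsq b a c (by unfold sqRank at h ⊢; linarith)),
      right a b c (hsq c a b (by unfold sqRank at h ⊢; linarith))
        (hsq c b a (by unfold sqRank at h ⊢; linarith))⟩
  have hJ := hq.jacobi_of_comparable (Or.inr hyx) (Or.inr (hzy.trans hyx)) (Or.inr hzy)
  simp only [bracketComm_eq_relCoef] at hJ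
  have hl : x ≠ y → wordClass w (inContext u (z :: v) (pairReduct x y)) =
      -F y x z + relCoef x y •
        (F (meet₁ x y) (meet₂ x y) z + F (meet₂ x y) (meet₁ x y) z) :=
    fun h => map_inContext_pairReduct _ u (z :: v) h
  have hr : y ≠ z → wordClass w (inContext (u ++ [x]) v (pairReduct y z)) =
      -F x z y + relCoef y z •
        (F x (meet₁ y z) (meet₂ y z) + F x (meet₂ y z) (meet₁ y z)) := by
    intro h
    simp only [hF]
    exact map_inContext_pairReduct _ (u ++ [x]) v h
  have swapl : ∀ a b c, b.rank < a.rank →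
      WordLT (u ++ b :: a :: c :: v) (u ++ a :: b :: c :: v) :=
    fun a b c h => wordLT_swap u (c :: v) h
  have swapr : ∀ a b c, b.rank < a.rank →
      WordLT (u ++ c :: b :: a :: v) (u ++ c :: a :: b :: v) := by
    intro a b c h
    have := wordLT_swap (u ++ [c]) v h
    simpa using this
  by_cases hxy : x = y
  · by_cases hyz : y = z
    · subst hxy hyz
      rw [map_inContext_pairReduct_self, map_inContext_pairReduct_self]
    · subst hxy
      have hlt := hzy.rank_lt (Ne.symm hyz)
      have h1 : WordLT (u ++ x :: z :: x :: v) w := swapr _ _ _ hlt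
      have h2 : WordLT (u ++ z :: x :: x :: v) w := (swapl _ _ _ hlt).trans h1
      have e1 := left x z x h1 h2
      have e2 := right x x z h2 h2
      rw [relCoef_self, zero_smul, ← two_nsmul, smul_eq_zero_iff_right two_ne_zero] at e2
      rw [relCoef_self, zero_smul, zero_smul, sub_zero, zero_add, ← two_nsmul,
        smul_eq_zero_iff_right two_ne_zero] at hJ
      rw [map_inContext_pairReduct_self, hr hyz]
      rw [e2, add_zero] at e1
      rw [e1]
      rw [← neg_eq_zero] at hJ
      rw [← hJ]
      abel
  · have hlt := hyx.rank_lt (Ne.symm hxy)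
    have h1 : WordLT (u ++ y :: x :: z :: v) w := swapl _ _ _ hlt
    by_cases hyz : y = z
    · subst hyz
      have h2 : WordLT (u ++ y :: y :: x :: v) w := (swapr _ _ _ hlt).trans h1
      have e1 := right x y y h1 h2
      have e2 := left y y x h2 h2
      rw [relCoef_self, zero_smul, ← two_nsmul, smul_eq_zero_iff_right two_ne_zero] at e2
      rw [relCoef_self, zero_smul, zero_smul, sub_zero, add_zero, ← two_nsmul,
        smul_eq_zero_iff_right two_ne_zero] at hJ
      rw [map_inContext_pairReduct_self, hl hxy]
      rw [e2, add_zero] at e1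
      rw [e1, ← hJ]
      abel
    · have hlt' := hzy.rank_lt (Ne.symm hyz)
      have h2 : WordLT (u ++ y :: z :: x :: v) w := (swapr _ _ _ (hlt'.trans hlt)).trans h1
      have h3 : WordLT (u ++ x :: z :: y :: v) w := swapr _ _ _ hlt'
      have h4 : WordLT (u ++ z :: x :: y :: v) w := (swapl _ _ _ (hlt'.trans hlt)).trans h3
      have h5 : WordLT (u ++ z :: y :: x :: v) w := (swapr _ _ _ hlt).trans h4
      have e1 := right x z y h1 h2
      have e2 := left y z x h2 h5
      have e3 := left x z y h3 h4
      have e4 := right x y z h4 h5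
      rw [hl hxy, hr hyz, eq_sub_of_add_eq e1, eq_sub_of_add_eq e2, eq_sub_of_add_eq e3,
        eq_sub_of_add_eq e4, ← sub_eq_zero, ← hJ]
      abel

theorem map_inContext_eq_sum {N : Type*} [AddCommGroup N] [Module ℂ N]
    (S : (List AffineLabel →₀ ℂ) →ₗ[ℂ] N) (u v : List AffineLabel)
    (p : List AffineLabel →₀ ℂ) :
    S (inContext u v p) = p.sum fun w c => c • S (Finsupp.single (u ++ (w ++ v)) 1) := by
  conv_lhs => rw [← Finsupp.sum_single p]
  rw [Finsupp.sum, map_sum, map_sum, Finsupp.sum]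
  refine Finset.sum_congr rfl fun w _ => ?_
  rw [inContext_single, ← map_smul, Finsupp.smul_single, smul_eq_mul, mul_one]

/-- Rewriting steps at disjoint places are confluent. -/
theorem wordClass_disjoint (u t v : List AffineLabel) {x y x' y' : AffineLabel}
    (h : Below y x) (h' : Below y' x') :
    wordClass (u ++ x :: y :: (t ++ x' :: y' :: v))
        (inContext u (t ++ x' :: y' :: v) (pairReduct x y)) =
      wordClass (u ++ x :: y :: (t ++ x' :: y' :: v))
        (inContext (u ++ x :: y :: t) v (pairReduct x' y')) := by
  obtain ⟨w, hw⟩ : ∃ w, w = u ++ x :: y :: (t ++ x' :: y' :: v) := ⟨_, rfl⟩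
  have hw' : w = (u ++ x :: y :: t) ++ x' :: y' :: v := by simp [hw]
  rw [← hw, map_inContext_eq_sum, map_inContext_eq_sum]
  have h1 : ∀ w₁ ∈ (pairReduct x y).support,
      wordClass w (Finsupp.single (u ++ (w₁ ++ (t ++ x' :: y' :: v))) 1) =
        (pairReduct x' y').sum fun w₂ c =>
          c • wordClass w (Finsupp.single (u ++ (w₁ ++ (t ++ (w₂ ++ v)))) 1) := by
    intro w₁ hw₁
    have hlt := wordLT_of_mem_pairReduct h hw₁ u (t ++ x' :: y' :: v)
    have e : u ++ (w₁ ++ (t ++ x' :: y' :: v)) = (u ++ w₁ ++ t) ++ x' :: y' :: v := by simp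
    rw [← hw, e] at hlt
    rw [e, wordClass_eq hlt (WordRed.mk (u ++ w₁ ++ t) v h'), map_inContext_eq_sum]
    simp only [List.append_assoc]
  have h2 : ∀ w₂ ∈ (pairReduct x' y').support,
      wordClass w (Finsupp.single ((u ++ x :: y :: t) ++ (w₂ ++ v)) 1) =
        (pairReduct x y).sum fun w₁ c =>
          c • wordClass w (Finsupp.single (u ++ (w₁ ++ (t ++ (w₂ ++ v)))) 1) := by
    intro w₂ hw₂
    have hlt := wordLT_of_mem_pairReduct h' hw₂ (u ++ x :: y :: t) v
    have e : (u ++ x :: y :: t) ++ (w₂ ++ v) = u ++ x :: y :: (t ++ (w₂ ++ v)) := by simp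
    rw [← hw', e] at hlt
    rw [e, wordClass_eq hlt (WordRed.mk u (t ++ (w₂ ++ v)) h), map_inContext_eq_sum]
  calc
    _ = (pairReduct x y).sum fun w₁ c => (pairReduct x' y').sum fun w₂ d =>
        c • d • wordClass w (Finsupp.single (u ++ (w₁ ++ (t ++ (w₂ ++ v)))) 1) :=
      Finsupp.sum_congr fun w₁ hw₁ => by rw [h1 w₁ hw₁, Finsupp.smul_sum]
    _ = (pairReduct x' y').sum fun w₂ d => (pairReduct x y).sum fun w₁ c =>
        c • d • wordClass w (Finsupp.single (u ++ (w₁ ++ (t ++ (w₂ ++ v)))) 1) :=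
      Finsupp.sum_comm _ _ _
    _ = _ := Finsupp.sum_congr fun w₂ hw₂ => by
      rw [h2 w₂ hw₂, Finsupp.smul_sum]
      exact Finsupp.sum_congr fun w₁ _ => smul_comm _ _ _

theorem wordRed_resolve (w : List AffineLabel) (p p' : List AffineLabel →₀ ℂ)
    (hp : WordRed w p) (hp' : WordRed w p') : p - p' ∈ relationsBelow WordRed WordLT w := by
  suffices H : ∀ (u t v u' v' : List AffineLabel) (x y x' y' : AffineLabel),
      u' = u ++ t → u ++ x :: y :: v = u' ++ x' :: y' :: v' → Below y x → Below y' x' →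
      wordClass (u ++ x :: y :: v) (inContext u v (pairReduct x y)) =
        wordClass (u ++ x :: y :: v) (inContext u' v' (pairReduct x' y')) by
    rw [← Submodule.Quotient.mk_eq_zero, ← Submodule.mkQ_apply, map_sub, sub_eq_zero]
    obtain ⟨u, v, h⟩ := hp
    generalize hw : u ++ _ = w at hp'
    obtain ⟨u', v', h'⟩ := hp'
    rcases List.append_eq_append_iff.1 hw with ⟨t, ht, -⟩ | ⟨t, ht, -⟩
    · rw [← hw]
      exact H u t v u' v' _ _ _ _ ht hw h h'
    · exact (H u' t v' u v _ _ _ _ ht hw.symm h' h).symm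
  rintro u t v _ v' x y x' y' rfl hw h h'
  rw [List.append_assoc, List.append_cancel_left_eq] at hw
  match t, hw with
  | [], hw =>
    simp only [List.nil_append, List.cons.injEq] at hw
    obtain ⟨rfl, rfl, rfl⟩ := hw
    rw [List.append_nil]
  | [a], hw =>
    simp only [List.cons_append, List.nil_append, List.cons.injEq] at hw
    obtain ⟨rfl, rfl, rfl⟩ := hw
    exact wordClass_overlap u v' h h'
  | a :: b :: t, hw =>
    simp only [List.cons_append, List.cons.injEq] at hw
    obtain ⟨rfl, rfl, rfl⟩ := hw
    exact wordClass_disjoint u t v' h h'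

/-- The normal form of a word. -/
def normalForm : List AffineLabel → (List AffineLabel →₀ ℂ) :=
  (exists_normalForm wordLT_wf wordRed_wordLT wordRed_resolve).choose

theorem normalForm_eq (w : List AffineLabel) (p : List AffineLabel →₀ ℂ) (h : WordRed w p) :
    normalForm w = Finsupp.linearCombination ℂ normalForm p :=
  (exists_normalForm wordLT_wf wordRed_wordLT wordRed_resolve).choose_spec.1 w p h

theorem normalForm_of_irreducible (w : List AffineLabel) (h : ∀ p, ¬ WordRed w p) :
    normalForm w = Finsupp.single w 1 :=
  (exists_normalForm wordLT_wf wordRed_wordLT wordRed_resolve).choose_spec.2 w h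

end AffineLabel

end

/-! ### The quadrics in coordinates -/

noncomputable section

namespace SpinorLabel

/-- The coefficient of the product of two labels in the quadric `s`. -/
def pairCoef (s : Fin 5 ⊕ Fin 5) (a b : SpinorLabel) : ℤ := if vec a b = s then sgn a b else 0

theorem pairCoef_comm (s : Fin 5 ⊕ Fin 5) (a b : SpinorLabel) :
    pairCoef s a b = pairCoef s b a := by
  rw [pairCoef, pairCoef, vec_comm, sgn_comm]

theorem sum_terms {M : Type*} [AddCommGroup M] (s : Fin 5 ⊕ Fin 5)
    (h : SpinorLabel → SpinorLabel → M) :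
    ((terms s).map fun t => t.1 • (h t.2.1 t.2.2 + h t.2.2 t.2.1)).sum =
      ∑ a, ∑ b, pairCoef s a b • h a b := by
  have key : ∀ s a b, pairCoef s a b = ((terms s).map fun t =>
      t.1 * ((if t.2.1 = a then if t.2.2 = b then 1 else 0 else 0) +
        if t.2.1 = b then if t.2.2 = a then 1 else 0 else 0)).sum := by
    decide +kernel
  simp only [key]
  generalize terms s = T
  induction T with
  | nil => simp
  | cons t T ih =>
    have h1 : t.1 • (h t.2.1 t.2.2 + h t.2.2 t.2.1) = ∑ a, ∑ b,
        (t.1 * ((if t.2.1 = a then if t.2.2 = b then 1 else 0 else 0) +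
          if t.2.1 = b then if t.2.2 = a then 1 else 0 else 0)) • h a b := by
      simp only [add_smul, Finset.sum_add_distrib, mul_smul, ite_smul, one_smul, zero_smul,
        smul_add, smul_ite, smul_zero, Finset.sum_ite_eq, Finset.mem_univ, if_true,
        Finset.sum_ite_irrel, Finset.sum_const_zero]
    simp only [List.map_cons, List.sum_cons, ih, h1, add_smul, Finset.sum_add_distrib]

end SpinorLabel

open SpinorLabel AffineLabel

/-- All labels of levels between `N` and `N'`. -/
def window (N N' : ℤ) : Finset AffineLabel :=
  (Finset.univ ×ˢ Finset.Icc N N').map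
    ⟨fun p => ⟨p.1, p.2⟩, fun _ _ h => Prod.ext (congrArg label h) (congrArg level h)⟩

theorem mem_window {N N' : ℤ} {x : AffineLabel} :
    x ∈ window N N' ↔ N ≤ x.level ∧ x.level ≤ N' := by
  simp only [window, Finset.mem_map, Finset.mem_product, Finset.mem_univ, true_and,
    Finset.mem_Icc, Prod.exists]
  constructor
  · rintro ⟨a, l, h, rfl⟩
    exact h
  · intro h
    exact ⟨x.label, x.level, h, rfl⟩

theorem sum_window {M : Type*} [AddCommMonoid M] (N N' : ℤ) (f : AffineLabel → M) :
    ∑ x ∈ window N N', f x = ∑ a, ∑ l ∈ Finset.Icc N N', f ⟨a, l⟩ := by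
  rw [window, Finset.sum_map, Finset.sum_product]
  rfl

theorem coeff_spinorSeries_mul (N N' : ℤ) (a b : SpinorLabel) (k : ℤ) :
    (spinorSeries N N' a * spinorSeries N N' b).coeff k =
      ∑ l ∈ Finset.Icc N N', ∑ l' ∈ Finset.Icc N N',
        if l + l' = k then MvPolynomial.X ⟨a, l⟩ * MvPolynomial.X ⟨b, l'⟩ else 0 := by
  unfold spinorSeries
  rw [Finset.sum_mul_sum, AddMonoidAlgebra.coeff_sum, Finset.sum_apply']
  refine Finset.sum_congr rfl fun l _ => ?_
  rw [AddMonoidAlgebra.coeff_sum, Finset.sum_apply']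
  refine Finset.sum_congr rfl fun l' _ => ?_
  rw [← LaurentPolynomial.single_eq_C_mul_T, ← LaurentPolynomial.single_eq_C_mul_T,
    AddMonoidAlgebra.single_mul_single, AddMonoidAlgebra.coeff_single, Finsupp.single_apply]

/-- Twice the coefficient of `z^k` in a quadric, as a sum over all ordered pairs of labels. -/
theorem two_smul_affineRelation (N N' : ℤ) (s : Fin 5 ⊕ Fin 5) (k : ℤ) :
    (2 : ℤ) • affineRelation N N' s k = ∑ x ∈ window N N', ∑ y ∈ window N N',
      if x.level + y.level = k then
        pairCoef s x.label y.label • (MvPolynomial.X x * MvPolynomial.X y) else 0 := by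
  have h1 : affineRelation N N' s k = ((terms s).map fun t =>
      t.1 • (spinorSeries N N' t.2.1 * spinorSeries N N' t.2.2).coeff k).sum := by
    rw [affineRelation, pureSpinorEquation_eq_sum]
    generalize terms s = T
    induction T with
    | nil => simp
    | cons t T ih =>
      rw [List.map_cons, List.map_cons, List.sum_cons, List.sum_cons, ← ih,
        AddMonoidAlgebra.coeff_add, Finsupp.add_apply, AddMonoidAlgebra.coeff_smul,
        Finsupp.smul_apply]
  have h2 : (2 : ℤ) • affineRelation N N' s k = ∑ a, ∑ b, pairCoef s a b •
      (spinorSeries N N' a * spinorSeries N N' b).coeff k := by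
    rw [← sum_terms, h1]
    generalize terms s = T
    induction T with
    | nil => simp
    | cons t T ih =>
      rw [List.map_cons, List.map_cons, List.sum_cons, List.sum_cons, smul_add, ih,
        mul_comm (spinorSeries N N' t.2.2), smul_comm, two_smul]
  rw [h2, sum_window]
  refine Finset.sum_congr rfl fun a _ => ?_
  simp only [sum_window]
  rw [Finset.sum_comm (s := Finset.Icc N N')]
  refine Finset.sum_congr rfl fun b _ => ?_
  rw [coeff_spinorSeries_mul, Finset.smul_sum]
  refine Finset.sum_congr rfl fun l _ => ?_
  rw [Finset.smul_sum]
  refine Finset.sum_congr rfl fun l' _ => ?_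
  rw [smul_ite, smul_zero]

/-! ### Linear functionals on the algebras `A[X]` -/

open MvPolynomial (pderiv constantCoeff)

/-- The coefficient of `λ^x`. -/
def linCoeff (x : AffineLabel) : AffinePoly →ₗ[ℂ] ℂ :=
  (MvPolynomial.aeval fun _ => (0 : ℂ)).toLinearMap ∘ₗ (pderiv x).toLinearMap

/-- The second derivative at the origin along `λ^x` and `λ^y`. -/
def hessian (x y : AffineLabel) : AffinePoly →ₗ[ℂ] ℂ :=
  linCoeff x ∘ₗ (pderiv y).toLinearMap

theorem linCoeff_apply (x : AffineLabel) (p : AffinePoly) :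
    linCoeff x p = constantCoeff (pderiv x p) := by
  simp [linCoeff]

theorem hessian_apply (x y : AffineLabel) (p : AffinePoly) :
    hessian x y p = constantCoeff (pderiv x (pderiv y p)) := by
  simp [hessian, linCoeff_apply]

theorem linCoeff_X (x y : AffineLabel) :
    linCoeff x (MvPolynomial.X y) = if x = y then 1 else 0 := by
  rw [linCoeff_apply, MvPolynomial.pderiv_X, Pi.single_apply]
  simp only [eq_comm (a := y)]
  split_ifs <;> simp

theorem linCoeff_mul (x : AffineLabel) (p q : AffinePoly) :
    linCoeff x (p * q) = linCoeff x p * constantCoeff q + constantCoeff p * linCoeff x q := by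
  simp only [linCoeff_apply, MvPolynomial.pderiv_mul, map_add, map_mul]

theorem hessian_mul (x y : AffineLabel) (p q : AffinePoly) :
    hessian x y (p * q) = hessian x y p * constantCoeff q + linCoeff x p * linCoeff y q +
      linCoeff y p * linCoeff x q + constantCoeff p * hessian x y q := by
  simp only [linCoeff_apply, hessian_apply, MvPolynomial.pderiv_mul, map_add, map_mul]
  ring

theorem hessian_X (x y z : AffineLabel) : hessian x y (MvPolynomial.X z) = 0 := by
  rw [hessian_apply, MvPolynomial.pderiv_X, Pi.single_apply]
  split_ifs <;> simp

theorem eq_zero_of_two_smul {M : Type*} [AddCommGroup M] [Module ℂ M] {m : M}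
    (h : (2 : ℤ) • m = 0) : m = 0 := by
  rw [← Int.cast_smul_eq_zsmul ℂ] at h
  exact (smul_eq_zero.1 h).resolve_left (by norm_num)

theorem eq_zero_of_add_self {M : Type*} [AddCommGroup M] [Module ℂ M] {m : M}
    (h : m + m = 0) : m = 0 :=
  eq_zero_of_two_smul ((two_smul ℤ m).trans h)

theorem constantCoeff_affineRelation (N N' : ℤ) (s : Fin 5 ⊕ Fin 5) (k : ℤ) :
    constantCoeff (affineRelation N N' s k) = 0 := by
  apply eq_zero_of_two_smul
  rw [← map_zsmul, two_smul_affineRelation, map_sum]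
  refine Finset.sum_eq_zero fun x _ => ?_
  rw [map_sum]
  refine Finset.sum_eq_zero fun y _ => ?_
  split_ifs <;> simp

theorem linCoeff_affineRelation (x : AffineLabel) (N N' : ℤ) (s : Fin 5 ⊕ Fin 5) (k : ℤ) :
    linCoeff x (affineRelation N N' s k) = 0 := by
  apply eq_zero_of_two_smul
  rw [← map_zsmul, two_smul_affineRelation, map_sum]
  refine Finset.sum_eq_zero fun y _ => ?_
  rw [map_sum]
  refine Finset.sum_eq_zero fun z _ => ?_
  split_ifs
  · rw [map_zsmul, linCoeff_mul]
    simp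
  · simp

theorem hessian_affineRelation {x y : AffineLabel} {N N' : ℤ} (hx : x ∈ window N N')
    (hy : y ∈ window N N') (s : Fin 5 ⊕ Fin 5) (k : ℤ) :
    hessian x y (affineRelation N N' s k) =
      if x.level + y.level = k then (pairCoef s x.label y.label : ℂ) else 0 := by
  rw [← sub_eq_zero]
  apply eq_zero_of_two_smul
  rw [smul_sub, ← map_zsmul, two_smul_affineRelation]
  have h1 : ∀ u v : AffineLabel, hessian x y (if u.level + v.level = k then
      pairCoef s u.label v.label • (MvPolynomial.X u * MvPolynomial.X v) else 0) =
      (if x = u then if y = v then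
        (if u.level + v.level = k then (pairCoef s u.label v.label : ℂ) else 0) else 0 else 0) +
      (if y = u then if x = v then
        (if u.level + v.level = k then (pairCoef s u.label v.label : ℂ) else 0) else 0 else 0) := by
    intro u v
    by_cases h : u.level + v.level = k
    · rw [if_pos h, map_zsmul, hessian_mul, hessian_X, hessian_X]
      simp only [if_pos h, linCoeff_X, zsmul_eq_mul, MvPolynomial.constantCoeff_X, mul_zero,
        zero_add, add_zero]
      split_ifs <;> simp [mul_add]
    · simp [h]
  simp only [map_sum, h1, Finset.sum_add_distrib]
  simp only [Finset.sum_ite_eq, hx, hy, if_true, Finset.sum_ite_irrel, Finset.sum_const_zero]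
  rw [add_comm y.level, pairCoef_comm s y.label]
  rw [two_smul, sub_self]

theorem subset_window {X : Set AffineLabel} {N N' : ℤ}
    (h : X ⊆ Set.Icc ⟨s0, N⟩ ⟨s1, N'⟩) : X ⊆ window N N' :=
  fun _ hx => mem_window.2 ⟨level_le_of_le (h hx).1, level_le_of_le (h hx).2⟩

theorem subset_Icc_of_subset_window {X : Set AffineLabel} {N N' : ℤ} (h : X ⊆ window N N') :
    X ⊆ Set.Icc ⟨s0, N⟩ ⟨s1, N'⟩ :=
  fun _ hx => mem_Icc_s0_s1 (mem_window.1 (h hx)).1 (mem_window.1 (h hx)).2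

/-- A linear functional on polynomials that kills the multiples of the generators of the ideal
descends to `A[X]`. -/
theorem exists_functional {X : Set AffineLabel} (φ : AffinePoly →ₗ[ℂ] ℂ)
    (h1 : ∀ f, ∀ x ∉ X, φ (f * MvPolynomial.X x) = 0)
    (h2 : ∀ f N N', X ⊆ window N N' → ∀ s k, φ (f * affineRelation N N' s k) = 0) :
    ∃ ψ : SpinorAlgebra X →ₗ[ℂ] ℂ, ∀ p, ψ (Ideal.Quotient.mkₐ ℂ (relationIdeal X) p) = φ p := by
  have h3 : ∀ p ∈ relationIdeal X, ∀ f, φ (f * p) = 0 := by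
    intro p hp
    refine Submodule.span_induction (p := fun p _ => ∀ f, φ (f * p) = 0) ?_ (by simp)
      (fun p q _ _ hp hq f => by rw [mul_add, map_add, hp, hq, add_zero])
      (fun g p _ hp f => by rw [smul_eq_mul, ← mul_assoc, hp]) hp
    rintro _ (⟨x, hx, rfl⟩ | ⟨N, N', hN, s, k, rfl⟩) f
    · exact h1 f x hx
    · exact h2 f N N' (subset_window hN) s k
  have h4 : φ ∈ (Ideal.Quotient.mkₐ ℂ (relationIdeal X)).toLinearMap.dualMap.range := by
    rw [LinearMap.range_dualMap_eq_dualAnnihilator_ker, Submodule.mem_dualAnnihilator]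
    intro p hp
    have hp' : p ∈ relationIdeal X := Ideal.Quotient.eq_zero_iff_mem.1 hp
    simpa using h3 p hp' 1
  obtain ⟨ψ, hψ⟩ := h4
  exact ⟨ψ, fun p => LinearMap.congr_fun hψ p⟩

end

/-! ### The algebra of operators on words -/

noncomputable section

open SpinorLabel AffineLabel

/-- The action of a generator on words: put the letter in front and pass to the normal form. -/
def letterOp (x : AffineLabel) : Module.End ℂ (List AffineLabel →₀ ℂ) :=
  Finsupp.linearCombination ℂ fun w => normalForm (x :: w)

theorem letterOp_single (x : AffineLabel) (w : List AffineLabel) :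
    letterOp x (Finsupp.single w 1) = normalForm (x :: w) := by
  rw [letterOp, Finsupp.linearCombination_single, one_smul]

theorem letterOp_normalForm (x : AffineLabel) (w : List AffineLabel) :
    letterOp x (normalForm w) = normalForm (x :: w) := by
  rw [← letterOp_single]
  refine map_normalForm wordLT_wf wordRed_wordLT normalForm_eq normalForm_of_irreducible
    (letterOp x) (fun _ => True) (fun _ _ _ _ _ _ => trivial) ?_ trivial
  rintro _ _ - ⟨u, v, h⟩
  rw [letterOp_single, ← List.cons_append, normalForm_eq _ _ (WordRed.mk (x :: u) v h),
    map_inContext_eq_sum, map_inContext_eq_sum]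
  simp only [letterOp_single, Finsupp.linearCombination_single, one_smul, List.cons_append]

theorem letterOp_anticomm (x y : AffineLabel) :
    letterOp x * letterOp y + letterOp y * letterOp x = relCoef x y •
      (letterOp (meet₁ x y) * letterOp (meet₂ x y) +
        letterOp (meet₂ x y) * letterOp (meet₁ x y)) := by
  refine Finsupp.lhom_ext' fun w => LinearMap.ext_ring ?_
  have h := anticomm_of_respects (Finsupp.linearCombination ℂ normalForm) [] w x y
    (fun hb => by
      rw [Finsupp.linearCombination_single, one_smul]
      exact normalForm_eq _ _ (WordRed.mk [] w hb))
    (fun hb => by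
      rw [Finsupp.linearCombination_single, one_smul]
      exact normalForm_eq _ _ (WordRed.mk [] w hb))
  simp only [Finsupp.linearCombination_single, one_smul, List.nil_append] at h
  simpa only [LinearMap.comp_apply, Finsupp.lsingle_apply, LinearMap.add_apply,
    Module.End.mul_apply, LinearMap.smul_apply, letterOp_single, letterOp_normalForm] using h

/-- The action of the element `A_(s,k)`. -/
def vecOp (s : Fin 5 ⊕ Fin 5) (k : ℤ) : Module.End ℂ (List AffineLabel →₀ ℂ) :=
  sgn (incFst s k).label (incSnd s k).label •
    (letterOp (incFst s k) * letterOp (incSnd s k) +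
      letterOp (incSnd s k) * letterOp (incFst s k))

theorem letterOp_anticomm' (x y : AffineLabel) :
    letterOp x * letterOp y + letterOp y * letterOp x =
      sgn x.label y.label • vecOp (vec x.label y.label) (x.level + y.level) := by
  rw [letterOp_anticomm, relCoef, mul_smul]
  rfl

/-! ### The degree-one part of `A[X]` and its dual -/

section

variable (X : Set AffineLabel)

/-- The class of `λ^x` in the degree-one part of `A[X]`. -/
def coord (x : AffineLabel) : degreeOne X :=
  ⟨Ideal.Quotient.mkₐ ℂ (relationIdeal X) (MvPolynomial.X x),
    MvPolynomial.X x, MvPolynomial.isHomogeneous_X _ _, rfl⟩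

variable {X}

theorem coord_eq_zero {x : AffineLabel} (hx : x ∉ X) : coord X x = 0 := by
  apply Subtype.ext
  exact Ideal.Quotient.eq_zero_iff_mem.2 (Ideal.subset_span (Or.inl ⟨x, hx, rfl⟩))

theorem span_coord : Submodule.span ℂ (Set.range (coord X)) = ⊤ := by
  apply Submodule.map_injective_of_injective (degreeOne X).injective_subtype
  rw [Submodule.map_span, Submodule.map_top, Submodule.range_subtype, ← Set.range_comp]
  change _ = Submodule.map _ _
  rw [MvPolynomial.homogeneousSubmodule_one_eq_span_X, Submodule.map_span, ← Set.range_comp]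
  rfl

theorem exists_theta {x : AffineLabel} (hx : x ∈ X) :
    ∃ f : Module.Dual ℂ (degreeOne X), ∀ y, f (coord X y) = if x = y then 1 else 0 := by
  obtain ⟨ψ, hψ⟩ := exists_functional (X := X) (linCoeff x)
    (fun f y hy => by
      have : x ≠ y := by rintro rfl; exact hy hx
      rw [linCoeff_mul, linCoeff_X, if_neg this]
      simp)
    (fun f N N' _ s k => by
      rw [linCoeff_mul, linCoeff_affineRelation, constantCoeff_affineRelation]
      simp)
  refine ⟨ψ ∘ₗ (degreeOne X).subtype, fun y => ?_⟩
  rw [← linCoeff_X, ← hψ]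
  rfl

open Classical in
/-- The generator of `A^![X]` dual to `λ^x`, as a functional; zero if `x ∉ X`. -/
def theta (X : Set AffineLabel) (x : AffineLabel) : Module.Dual ℂ (degreeOne X) :=
  if hx : x ∈ X then (exists_theta hx).choose else 0

theorem theta_coord {x : AffineLabel} (hx : x ∈ X) (y : AffineLabel) :
    theta X x (coord X y) = if x = y then 1 else 0 := by
  rw [theta, dif_pos hx]
  exact (exists_theta hx).choose_spec y

theorem theta_of_notMem {x : AffineLabel} (hx : x ∉ X) : theta X x = 0 := dif_neg hx

theorem dual_ext {f g : Module.Dual ℂ (degreeOne X)}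
    (h : ∀ x ∈ X, f (coord X x) = g (coord X x)) : f = g := by
  refine LinearMap.ext_on_range span_coord fun x => ?_
  by_cases hx : x ∈ X
  · exact h x hx
  · rw [coord_eq_zero hx, map_zero, map_zero]

theorem eq_sum_theta {N N' : ℤ} (hX : X ⊆ window N N') (f : Module.Dual ℂ (degreeOne X)) :
    f = ∑ x ∈ window N N', f (coord X x) • theta X x := by
  refine dual_ext fun y hy => ?_
  rw [LinearMap.sum_apply, Finset.sum_eq_single_of_mem y (hX hy)]
  · rw [LinearMap.smul_apply, theta_coord hy, if_pos rfl, smul_eq_mul, mul_one]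
  · intro x _ hxy
    by_cases hx : x ∈ X
    · rw [LinearMap.smul_apply, theta_coord hx, if_neg hxy, smul_zero]
    · rw [coord_eq_zero hx, map_zero, zero_smul, LinearMap.zero_apply]

theorem pairCoef_eq_relCoef_mul (x y : AffineLabel)
    (s : Fin 5 ⊕ Fin 5) : pairCoef s x.label y.label =
      relCoef x y * pairCoef s (meet₁ x y).label (meet₂ x y).label := by
  unfold pairCoef meet₁ meet₂
  rw [vec_inc]
  split_ifs
  · rw [relCoef, mul_assoc, sgn_inc_mul_self, mul_one]
  · rw [mul_zero]

theorem exists_hessian_functional {x y : AffineLabel} (hx : x ∈ X) (hy : y ∈ X)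
    (hm : relCoef x y ≠ 0 → meet₁ x y ∈ X ∧ meet₂ x y ∈ X) :
    ∃ ψ : SpinorAlgebra X →ₗ[ℂ] ℂ, ∀ p, ψ (Ideal.Quotient.mkₐ ℂ (relationIdeal X) p) =
      hessian x y p - relCoef x y • hessian (meet₁ x y) (meet₂ x y) p := by
  have hX : ∀ {z w : AffineLabel}, z ∈ X → w ∉ X → z ≠ w := by
    rintro z w hz hw rfl
    exact hw hz
  have hmul : ∀ {z z' w : AffineLabel}, z ∈ X → z' ∈ X → w ∉ X → ∀ f : AffinePoly,
      hessian z z' (f * MvPolynomial.X w) = 0 := by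
    intro z z' w hz hz' hw f
    rw [hessian_mul, hessian_X, linCoeff_X, linCoeff_X, if_neg (hX hz hw), if_neg (hX hz' hw)]
    simp
  have hrel : ∀ {z z' : AffineLabel} {N N' : ℤ}, z ∈ X → z' ∈ X → X ⊆ window N N' →
      ∀ (f : AffinePoly) s k, hessian z z' (f * affineRelation N N' s k) =
        MvPolynomial.constantCoeff f *
          if z.level + z'.level = k then (pairCoef s z.label z'.label : ℂ) else 0 := by
    intro z z' N N' hz hz' hN f s k
    rw [hessian_mul, constantCoeff_affineRelation, linCoeff_affineRelation,
      linCoeff_affineRelation, hessian_affineRelation (hN hz) (hN hz')]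
    simp
  refine exists_functional (hessian x y - relCoef x y • hessian (meet₁ x y) (meet₂ x y)) ?_ ?_
  · intro f w hw
    rw [LinearMap.sub_apply, LinearMap.smul_apply, hmul hx hy hw, zero_sub, neg_eq_zero]
    by_cases h0 : relCoef x y = 0
    · rw [h0, zero_smul]
    · rw [hmul (hm h0).1 (hm h0).2 hw, smul_zero]
  · intro f N N' hN s k
    rw [LinearMap.sub_apply, LinearMap.smul_apply, hrel hx hy hN]
    by_cases h0 : sgn x.label y.label = 0
    · have h1 : relCoef x y = 0 := by rw [relCoef, h0, zero_mul]
      have h2 : pairCoef s x.label y.label = 0 := by rw [pairCoef, h0, ite_self]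
      rw [h1, h2, zero_smul]
      simp
    · have h1 : relCoef x y ≠ 0 := by
        refine mul_ne_zero h0 fun h => ?_
        have := sgn_inc_mul_self (vec x.label y.label) (x.level + y.level)
        rw [h] at this
        simp at this
      rw [hrel (hm h1).1 (hm h1).2 hN, pairCoef_eq_relCoef_mul, inc_level_add]
      split_ifs
      · push_cast
        rw [zsmul_eq_mul]
        ring
      · simp

/-- The symmetric tensor of two functionals. -/
def symTensor (X : Set AffineLabel) (x y : AffineLabel) :
    Module.Dual ℂ (degreeOne X) ⊗[ℂ] Module.Dual ℂ (degreeOne X) :=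
  theta X x ⊗ₜ theta X y + theta X y ⊗ₜ theta X x

theorem dualDistrib_symTensor {x y : AffineLabel} (hx : x ∈ X) (hy : y ∈ X) (u v : AffineLabel) :
    TensorProduct.dualDistrib ℂ _ _ (symTensor X x y) (coord X u ⊗ₜ coord X v) =
      hessian x y (MvPolynomial.X u * MvPolynomial.X v) := by
  rw [symTensor, map_add, LinearMap.add_apply, TensorProduct.dualDistrib_apply,
    TensorProduct.dualDistrib_apply, theta_coord hx, theta_coord hx, theta_coord hy,
    theta_coord hy, hessian_mul, hessian_X, hessian_X, linCoeff_X, linCoeff_X, linCoeff_X,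
    linCoeff_X]
  simp

theorem tensor_ext {N : Type*} [AddCommGroup N] [Module ℂ N]
    {f g : degreeOne X ⊗[ℂ] degreeOne X →ₗ[ℂ] N}
    (h : ∀ u v, f (coord X u ⊗ₜ coord X v) = g (coord X u ⊗ₜ coord X v)) : f = g := by
  refine TensorProduct.ext (LinearMap.ext_on_range span_coord fun u => ?_)
  exact LinearMap.ext_on_range span_coord fun v => h u v

theorem mul_coord (u v : AffineLabel) :
    (LinearMap.mul' ℂ (SpinorAlgebra X) ∘ₗ
      TensorProduct.map (degreeOne X).subtype (degreeOne X).subtype) (coord X u ⊗ₜ coord X v) =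
      Ideal.Quotient.mkₐ ℂ (relationIdeal X) (MvPolynomial.X u * MvPolynomial.X v) := by
  rw [map_mul]
  rfl

/-- The relations of `A^![X]`. -/
theorem symTensor_mem_dualRelations {x y : AffineLabel} (hx : x ∈ X) (hy : y ∈ X)
    (hm : relCoef x y ≠ 0 → meet₁ x y ∈ X ∧ meet₂ x y ∈ X) :
    symTensor X x y - relCoef x y • symTensor X (meet₁ x y) (meet₂ x y) ∈
      dualRelations (degreeOne X) := by
  obtain ⟨ψ, hψ⟩ := exists_hessian_functional hx hy hm
  have h : TensorProduct.dualDistrib ℂ _ _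
      (symTensor X x y - relCoef x y • symTensor X (meet₁ x y) (meet₂ x y)) =
      ψ ∘ₗ (LinearMap.mul' ℂ (SpinorAlgebra X) ∘ₗ
        TensorProduct.map (degreeOne X).subtype (degreeOne X).subtype) := by
    refine tensor_ext fun u v => ?_
    rw [LinearMap.comp_apply, mul_coord, hψ, map_sub, map_zsmul, LinearMap.sub_apply,
      LinearMap.smul_apply, dualDistrib_symTensor hx hy]
    by_cases h0 : relCoef x y = 0
    · rw [h0, zero_smul, zero_smul]
    · rw [dualDistrib_symTensor (hm h0).1 (hm h0).2]
  rw [dualRelations, Submodule.mem_comap, Submodule.mem_dualAnnihilator, h]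
  intro r hr
  rw [quadraticRelations, LinearMap.mem_ker] at hr
  rw [LinearMap.comp_apply, hr, map_zero]

/-! ### From words to `A^![X]` -/

/-- The generators of `A^![X]`. -/
def generator (X : Set AffineLabel) (x : AffineLabel) : KoszulDual X :=
  RingQuot.mkAlgHom ℂ (dualRel (degreeOne X)) (TensorAlgebra.ι ℂ (theta X x))

theorem generator_anticomm {x y : AffineLabel} (hx : x ∈ X) (hy : y ∈ X)
    (hm : relCoef x y ≠ 0 → meet₁ x y ∈ X ∧ meet₂ x y ∈ X) :
    generator X x * generator X y + generator X y * generator X x = relCoef x y •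
      (generator X (meet₁ x y) * generator X (meet₂ x y) +
        generator X (meet₂ x y) * generator X (meet₁ x y)) := by
  have h := RingQuot.mkAlgHom_rel ℂ (s := dualRel (degreeOne X))
    ⟨⟨_, symTensor_mem_dualRelations hx hy hm, rfl⟩, rfl⟩
  have h1 : ∀ x y, RingQuot.mkAlgHom ℂ (dualRel (degreeOne X))
      (tensorSquareι ℂ _ (symTensor X x y)) =
      generator X x * generator X y + generator X y * generator X x := by
    intro x y
    simp [symTensor, tensorSquareι, generator]
  rw [map_zero, map_sub, map_sub, map_zsmul, map_zsmul, h1, h1, sub_eq_zero] at h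
  exact h

/-- The value of a word in `A^![X]`. -/
def wordValue (X : Set AffineLabel) : (List AffineLabel →₀ ℂ) →ₗ[ℂ] KoszulDual X :=
  Finsupp.linearCombination ℂ fun w => (w.map (generator X)).prod

theorem wordValue_single (w : List AffineLabel) :
    wordValue X (Finsupp.single w 1) = (w.map (generator X)).prod := by
  rw [wordValue, Finsupp.linearCombination_single, one_smul]

theorem meet_mem [hX : X.OrdConnected] {x y : AffineLabel} (hx : x ∈ X) (hy : y ∈ X)
    (hyx : Below y x) (h : relCoef x y ≠ 0) : meet₁ x y ∈ X ∧ meet₂ x y ∈ X := by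
  have h0 := relCoef_ne_zero h
  rw [sgn_comm] at h0
  obtain ⟨⟨h1, h2⟩, ⟨h3, h4⟩, -⟩ := meet_between h0 hyx
  rw [meet₁_comm, meet₂_comm]
  exact ⟨hX.out hy hx ⟨h1.le, h2.le⟩, hX.out hy hx ⟨h3.le, h4.le⟩⟩

/-- In the algebra of a convex set of labels, a word in these labels has the same value as its
normal form. -/
theorem wordValue_normalForm [X.OrdConnected] {w : List AffineLabel} (hw : ∀ x ∈ w, x ∈ X) :
    wordValue X (normalForm w) = (w.map (generator X)).prod := by
  rw [← wordValue_single]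
  refine map_normalForm wordLT_wf wordRed_wordLT normalForm_eq normalForm_of_irreducible
    (wordValue X) (fun w => ∀ x ∈ w, x ∈ X) ?_ ?_ hw
  · rintro _ _ hw ⟨u, v, h⟩ w' hw'
    obtain ⟨w'', hw'', rfl⟩ := exists_of_mem_support_inContext hw'
    simp only [List.mem_append, List.mem_cons, or_imp, forall_and, forall_eq] at hw ⊢
    obtain ⟨hu, hx, hy, hv⟩ := hw
    refine ⟨hu, ?_, hv⟩
    rcases mem_support_pairReduct hw'' with ⟨-, rfl⟩ | ⟨h0, rfl | rfl⟩
    · simp [hx, hy]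
    · simp [meet_mem hx hy h h0]
    · simp [meet_mem hx hy h h0]
  · rintro _ _ hw ⟨u, v, h⟩
    rename_i x y
    simp only [List.mem_append, List.mem_cons, or_imp, forall_and, forall_eq] at hw
    obtain ⟨hu, hx, hy, hv⟩ := hw
    have key := generator_anticomm hx hy (meet_mem hx hy h)
    have hp : ∀ a b, wordValue X (Finsupp.single (u ++ a :: b :: v) 1) =
        (u.map (generator X)).prod * (generator X a * generator X b) *
          (v.map (generator X)).prod := by
      intro a b
      rw [wordValue_single]
      simp [mul_assoc]
    by_cases hxy : x = y
    · subst hxy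
      rw [map_inContext_pairReduct_self, hp]
      have key' : generator X x * generator X x + generator X x * generator X x = 0 := by
        rw [key, relCoef_self]
        exact zero_zsmul _
      rw [eq_zero_of_add_self key', mul_zero, zero_mul]
    · rw [map_inContext_pairReduct _ u v hxy, hp, hp, hp, hp, ← add_mul, ← mul_add,
        ← smul_mul_assoc, ← mul_smul_comm, ← key, mul_add, add_mul]
      abel

theorem adjoin_generator {N N' : ℤ} (hX : X ⊆ window N N') :
    Algebra.adjoin ℂ (Set.range fun x : X => generator X x) = ⊤ := by
  rw [eq_top_iff]
  rintro z -
  obtain ⟨t, rfl⟩ := RingQuot.mkAlgHom_surjective ℂ (dualRel (degreeOne X)) z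
  induction t using TensorAlgebra.induction with
  | algebraMap r =>
    rw [AlgHom.commutes]
    exact Subalgebra.algebraMap_mem _ r
  | ι f =>
    rw [eq_sum_theta hX f, map_sum, map_sum]
    refine Subalgebra.sum_mem _ fun x _ => ?_
    rw [map_smul, map_smul]
    apply Subalgebra.smul_mem
    by_cases hx : x ∈ X
    · exact Algebra.subset_adjoin ⟨⟨x, hx⟩, rfl⟩
    · rw [theta_of_notMem hx, map_zero, map_zero]
      exact Subalgebra.zero_mem _
  | mul a b ha hb =>
    rw [map_mul]
    exact Subalgebra.mul_mem _ ha hb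
  | add a b ha hb =>
    rw [map_add]
    exact Subalgebra.add_mem _ ha hb

/-- The words in the labels of `X` span `A^![X]`. -/
theorem span_words {N N' : ℤ} (hX : X ⊆ window N N') :
    Submodule.span ℂ {z | ∃ w : List AffineLabel, (∀ x ∈ w, x ∈ X) ∧
      z = (w.map (generator X)).prod} = ⊤ := by
  rw [eq_top_iff, ← Algebra.top_toSubmodule, ← adjoin_generator hX, Algebra.adjoin_eq_span]
  apply Submodule.span_mono
  intro z hz
  obtain ⟨l, hl, rfl⟩ := Submonoid.exists_list_of_mem_closure hz
  have : l ∈ Set.range (List.map fun x : X => generator X x) := by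
    rw [Set.range_list_map]
    exact hl
  obtain ⟨w, rfl⟩ := this
  refine ⟨w.map Subtype.val, ?_, ?_⟩
  · intro x hx
    obtain ⟨y, -, rfl⟩ := List.mem_map.1 hx
    exact y.2
  · rw [List.map_map]
    rfl

/-! ### From `A^![Y]` to operators -/

/-- The linear map from the dual of the degree-one part to operators on words that sends the
functional dual to `λ^x` to the action of `x`. -/
def dualOp (X : Set AffineLabel) (N N' : ℤ) :
    Module.Dual ℂ (degreeOne X) →ₗ[ℂ] Module.End ℂ (List AffineLabel →₀ ℂ) :=
  ∑ x ∈ window N N', (LinearMap.toSpanSingleton ℂ _ (letterOp x)) ∘ₗ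
    Module.Dual.eval ℂ (degreeOne X) (coord X x)

theorem dualOp_apply (N N' : ℤ) (f : Module.Dual ℂ (degreeOne X)) :
    dualOp X N N' f = ∑ x ∈ window N N', f (coord X x) • letterOp x := by
  simp [dualOp, LinearMap.sum_apply]

theorem lift_dualOp_tensorSquareι (N N' : ℤ)
    (t : Module.Dual ℂ (degreeOne X) ⊗[ℂ] Module.Dual ℂ (degreeOne X)) :
    TensorAlgebra.lift ℂ (dualOp X N N') (tensorSquareι ℂ _ t) =
      ∑ x ∈ window N N', ∑ y ∈ window N N',
        TensorProduct.dualDistrib ℂ _ _ t (coord X x ⊗ₜ coord X y) •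
          (letterOp x * letterOp y) := by
  induction t using TensorProduct.induction_on with
  | zero => simp
  | add a b ha hb => simp only [map_add, ha, hb, LinearMap.add_apply, add_smul,
      Finset.sum_add_distrib]
  | tmul f g =>
    simp only [tensorSquareι, LinearMap.comp_apply, TensorProduct.map_tmul, LinearMap.mul'_apply,
      map_mul, TensorAlgebra.lift_ι_apply, dualOp_apply, Finset.sum_mul_sum,
      TensorProduct.dualDistrib_apply, smul_mul_smul_comm]

/-- The quadratic relation of `A[X]` given by the coefficient of `z^k` in the quadric `s`. -/
theorem sum_coord_mem_quadraticRelations {N N' : ℤ} (hX : X ⊆ window N N')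
    (s : Fin 5 ⊕ Fin 5) (k : ℤ) :
    ∑ x ∈ window N N', ∑ y ∈ window N N', (if x.level + y.level = k then
      pairCoef s x.label y.label • (coord X x ⊗ₜ[ℂ] coord X y) else 0) ∈
      quadraticRelations (degreeOne X) := by
  have h : affineRelation N N' s k ∈ relationIdeal X :=
    Ideal.subset_span (Or.inr ⟨N, N', subset_Icc_of_subset_window hX, s, k, rfl⟩)
  have h1 : Ideal.Quotient.mkₐ ℂ (relationIdeal X) ((2 : ℤ) • affineRelation N N' s k) = 0 := by
    rw [map_zsmul, show Ideal.Quotient.mkₐ ℂ (relationIdeal X) (affineRelation N N' s k) = 0 from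
      Ideal.Quotient.eq_zero_iff_mem.2 h, smul_zero]
  rw [quadraticRelations, LinearMap.mem_ker, ← h1, two_smul_affineRelation]
  simp only [map_sum]
  refine Finset.sum_congr rfl fun x _ => Finset.sum_congr rfl fun y _ => ?_
  split_ifs
  · rw [map_zsmul, map_zsmul, mul_coord]
  · rw [map_zero, map_zero]

theorem dualDistrib_eq_zero {t : Module.Dual ℂ (degreeOne X) ⊗[ℂ] Module.Dual ℂ (degreeOne X)}
    (ht : t ∈ dualRelations (degreeOne X)) {r : degreeOne X ⊗[ℂ] degreeOne X}
    (hr : r ∈ quadraticRelations (degreeOne X)) : TensorProduct.dualDistrib ℂ _ _ t r = 0 := by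
  rw [dualRelations, Submodule.mem_comap, Submodule.mem_dualAnnihilator] at ht
  exact ht r hr

/-- A symmetric form orthogonal to the quadrics kills products whose symmetrizations depend only
on the weight. -/
theorem sum_smul_eq_zero {M : Type*} [AddCommGroup M] [Module ℂ M]
    {L : AffineLabel → AffineLabel → M} {A : Fin 5 ⊕ Fin 5 → ℤ → M}
    (hL : ∀ x y, L x y + L y x =
      sgn x.label y.label • A (vec x.label y.label) (x.level + y.level))
    {τ : AffineLabel → AffineLabel → ℂ} (hsymm : ∀ x y, τ x y = τ y x) {N N' : ℤ}
    (hsum : ∀ s k, ∑ x ∈ window N N', ∑ y ∈ window N N', (if x.level + y.level = k then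
      (pairCoef s x.label y.label : ℂ) * τ x y else 0) = 0) :
    ∑ x ∈ window N N', ∑ y ∈ window N N', τ x y • L x y = 0 := by
  apply eq_zero_of_two_smul
  -- Symmetrize, and sort the symmetrized products by weight.
  calc (2 : ℤ) • ∑ x ∈ window N N', ∑ y ∈ window N N', τ x y • L x y
      = ∑ x ∈ window N N', ∑ y ∈ window N N', τ x y • (L x y + L y x) := by
        simp only [smul_add, Finset.sum_add_distrib, two_smul]
        congr 1
        rw [Finset.sum_comm]
        exact Finset.sum_congr rfl fun x _ => Finset.sum_congr rfl fun y _ => by rw [hsymm]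
    _ = ∑ x ∈ window N N', ∑ y ∈ window N N', ∑ s, ∑ k ∈ Finset.Icc (N + N) (N' + N'),
          (if x.level + y.level = k then (pairCoef s x.label y.label : ℂ) * τ x y else 0) •
            A s k := by
        refine Finset.sum_congr rfl fun x hx => Finset.sum_congr rfl fun y hy => ?_
        rw [mem_window] at hx hy
        have hk : x.level + y.level ∈ Finset.Icc (N + N) (N' + N') :=
          Finset.mem_Icc.2 ⟨by linarith, by linarith⟩
        simp only [ite_smul, zero_smul, Finset.sum_ite_eq, hk, if_true]
        rw [hL, Finset.sum_eq_single_of_mem (vec x.label y.label)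
          (Finset.mem_univ _), pairCoef, if_pos rfl, mul_comm, mul_smul, Int.cast_smul_eq_zsmul]
        intro s _ hs
        rw [pairCoef, if_neg (Ne.symm hs), Int.cast_zero, zero_mul, zero_smul]
    _ = ∑ s, ∑ k ∈ Finset.Icc (N + N) (N' + N'), (∑ x ∈ window N N', ∑ y ∈ window N N',
          (if x.level + y.level = k then (pairCoef s x.label y.label : ℂ) * τ x y else 0)) •
            A s k := by
        simp only [Finset.sum_smul]
        rw [Finset.sum_congr rfl fun x _ => Finset.sum_comm, Finset.sum_comm]
        refine Finset.sum_congr rfl fun s _ => ?_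
        rw [Finset.sum_congr rfl fun x _ => Finset.sum_comm, Finset.sum_comm]
    _ = 0 := by
        simp only [hsum, zero_smul, Finset.sum_const_zero]

/-- The operators satisfy the relations of `A^![X]`. -/
theorem lift_dualOp_of_mem_dualRelations {N N' : ℤ} (hX : X ⊆ window N N')
    {t : Module.Dual ℂ (degreeOne X) ⊗[ℂ] Module.Dual ℂ (degreeOne X)}
    (ht : t ∈ dualRelations (degreeOne X)) :
    TensorAlgebra.lift ℂ (dualOp X N N') (tensorSquareι ℂ _ t) = 0 := by
  set τ : AffineLabel → AffineLabel → ℂ := fun x y =>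
    TensorProduct.dualDistrib ℂ _ _ t (coord X x ⊗ₜ coord X y) with hτ
  have hsymm : ∀ x y, τ x y = τ y x := by
    intro x y
    rw [hτ, ← sub_eq_zero, ← map_sub]
    apply dualDistrib_eq_zero ht
    rw [quadraticRelations, LinearMap.mem_ker, map_sub, mul_coord, mul_coord, mul_comm, sub_self]
  have hsum : ∀ s k, ∑ x ∈ window N N', ∑ y ∈ window N N', (if x.level + y.level = k then
      (pairCoef s x.label y.label : ℂ) * τ x y else 0) = 0 := by
    intro s k
    refine Eq.trans ?_ (dualDistrib_eq_zero ht (sum_coord_mem_quadraticRelations hX s k))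
    simp only [map_sum]
    refine Finset.sum_congr rfl fun x _ => Finset.sum_congr rfl fun y _ => ?_
    split_ifs
    · rw [map_zsmul, zsmul_eq_mul]
    · rw [map_zero]
  rw [lift_dualOp_tensorSquareι]
  have key := sum_smul_eq_zero (M := Module.End ℂ (List AffineLabel →₀ ℂ))
    (L := fun x y => letterOp x * letterOp y) (A := vecOp) letterOp_anticomm' hsymm hsum
  exact key

/-- The representation of `A^![X]` by operators on words. -/
def operatorRep {N N' : ℤ} (hX : X ⊆ window N N') :
    KoszulDual X →ₐ[ℂ] Module.End ℂ (List AffineLabel →₀ ℂ) :=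
  RingQuot.liftAlgHom ℂ ⟨TensorAlgebra.lift ℂ (dualOp X N N'), by
    rintro x y ⟨⟨t, ht, rfl⟩, rfl⟩
    rw [lift_dualOp_of_mem_dualRelations hX ht, map_zero]⟩

theorem operatorRep_koszulDualMap_generator {Y : Set AffineLabel} (h : X ⊆ Y) {N N' : ℤ}
    (hY : Y ⊆ window N N') {x : AffineLabel} (hx : x ∈ X) :
    operatorRep hY (koszulDualMap h (generator X x)) = letterOp x := by
  have h1 : koszulDualMap h (generator X x) = RingQuot.mkAlgHom ℂ (dualRel (degreeOne Y))
      (TensorAlgebra.ι ℂ ((degreeOneMap (degreeOne Y) (degreeOne X) (projection h)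
        (degreeOne_le_comap_projection h)).dualMap (theta X x))) := by
    rw [koszulDualMap, QuadraticDual.map, generator, RingQuot.liftAlgHom_mkAlgHom_apply]
    simp [tensorDualMap]
  have h2 : ∀ y, degreeOneMap (degreeOne Y) (degreeOne X) (projection h)
      (degreeOne_le_comap_projection h) (coord Y y) = coord X y := fun _ => rfl
  rw [h1, operatorRep, RingQuot.liftAlgHom_mkAlgHom_apply, TensorAlgebra.lift_ι_apply,
    dualOp_apply, Finset.sum_eq_single_of_mem x (hY (h hx))]
  · rw [LinearMap.dualMap_apply, h2, theta_coord hx, if_pos rfl, one_smul]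
  · intro y _ hxy
    rw [LinearMap.dualMap_apply, h2, theta_coord hx, if_neg (Ne.symm hxy), zero_smul]

theorem prod_letterOp (w : List AffineLabel) :
    (w.map letterOp).prod (Finsupp.single [] 1) = normalForm w := by
  induction w with
  | nil =>
    rw [normalForm_of_irreducible]
    · rfl
    · rintro p hp
      generalize hw : ([] : List AffineLabel) = w at hp
      obtain ⟨u, v, -⟩ := hp
      simp at hw
  | cons x w ih =>
    rw [List.map_cons, List.prod_cons, Module.End.mul_apply, ih, letterOp_normalForm]

/-- The map of Koszul duals is injective for the inclusion of a convex set of labels. -/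
theorem koszulDualMap_injective {Y : Set AffineLabel} [X.OrdConnected] (h : X ⊆ Y) {N N' : ℤ}
    (hY : Y ⊆ window N N') : Function.Injective (koszulDualMap h) := by
  -- A left inverse: act on the empty word and evaluate the resulting words in `A^![X]`.
  have key : wordValue X ∘ₗ LinearMap.applyₗ (Finsupp.single [] 1) ∘ₗ
      (operatorRep hY).toLinearMap ∘ₗ (koszulDualMap h).toLinearMap = LinearMap.id := by
    refine LinearMap.ext_on (span_words (h.trans hY)) ?_
    rintro _ ⟨w, hw, rfl⟩
    have h1 : operatorRep hY (koszulDualMap h (w.map (generator X)).prod) =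
        (w.map letterOp).prod := by
      rw [map_list_prod, map_list_prod, List.map_map, List.map_map]
      congr 1
      exact List.map_congr_left fun x hx => operatorRep_koszulDualMap_generator h hY (hw x hx)
    simp only [LinearMap.comp_apply, AlgHom.toLinearMap_apply, LinearMap.applyₗ_apply_apply, h1,
      prod_letterOp, wordValue_normalForm hw, LinearMap.id_apply]
  intro a b hab
  have ha := LinearMap.congr_fun key a
  have hb := LinearMap.congr_fun key b
  simp only [LinearMap.comp_apply, AlgHom.toLinearMap_apply, LinearMap.id_apply] at ha hb
  rw [← ha, hab, hb]

end

end

theorem propositionP (γ γ' δ δ' : AffineLabel) (h : Set.Icc γ γ' ⊆ Set.Icc δ δ') :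
    Function.Injective (koszulDualMap h) :=
  koszulDualMap_injective h (N := δ.level) (N' := δ'.level) fun _ hx =>
    mem_window.2 ⟨AffineLabel.level_le_of_le hx.1, AffineLabel.level_le_of_le hx.2⟩
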